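/- For $z\in\mathbb{C}$ and $\tau$ in the upper half plane $\mathfrak{H}$ let $$\theta(z,\tau)=\frac1i\sum_{n\in\mathbb{Z}}(-1)^n e^{\pi i\tau(n+\frac12)^2}e^{\pi i z(2n+1)},$$ write $\theta'$ for $\partial\theta/\partial z$, and suppress $\tau$ from the notation. For an integer $l\ge 2$, an integer $a$ not divisible by $l$, and an integer $k\geq 1$, define the function $s_{a/l}^{(k)}\colon\mathfrak{H}\to\mathbb{C}$ by $$s_{a/l}^{(k)}(\tau)=(2\pi i)^{-k}\left(\frac{\partial^k}{\partial z^k}\right)_{z=0}\log\left(\frac{z\,\theta(z+a/l)\,\theta'(0)}{\theta(z)\,\theta(a/l)}\right),$$ where the argument of the logarithm is extended holomorphically to $z=0$ by the value $1$, and $\log$ is the branch with $\log 1=0$. Polynomials below have constant complex coefficients, that is, coefficients independent of $\tau$. Then: 1. If $l\ge 5$, then every $s_{a/l}^{(k)}$ ($k\ge1$, $l\nmid a$) is a polynomial in the functions $s_{b/l}^{(1)}$, $1\le b\le l-1$. 2. If $l=4$, then every $s_{a/4}^{(k)}$ ($k\ge1$, $4\nmid a$) is a polynomial in $s_{1/4}^{(1)}$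 and $s_{1/4}^{(2)}$. 3. If $l=3$, then every $s_{a/3}^{(k)}$ ($k\ge1$, $3\nmid a$) is a polynomial in $s_{1/3}^{(1)}$ and $s_{1/3}^{(3)}$. 4. If $l=2$, then every $s_{a/2}^{(k)}$ ($k\ge1$, $a$ odd) is a polynomial in $s_{1/2}^{(2)}$ and $s_{1/2}^{(4)}$. -/

import Mathlib

noncomputable section

open Complex

/-- The theta function with characteristic
`θ(z, τ) = (1/i) ∑_{n ∈ ℤ} (-1)^n e^{π i τ (n + 1/2)²} e^{π i z (2n + 1)}`. -/
def thetaOneOne (z τ : ℂ) : ℂ :=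
  (1 / I) * ∑' n : ℤ, (-1 : ℂ) ^ n *
    Complex.exp (Real.pi * I * τ * ((n : ℂ) + 1 / 2) ^ 2) *
    Complex.exp (Real.pi * I * z * (2 * (n : ℂ) + 1))

/-- `θ'(0, τ)`, the derivative being taken in the elliptic variable. -/
def thetaOneOneDerivZero (τ : ℂ) : ℂ :=
  deriv (fun z : ℂ => thetaOneOne z τ) 0

/-- The function `z ↦ z θ(z + α, τ) θ'(0, τ) / (θ(z, τ) θ(α, τ))`. Its removable singularity at
`z = 0` is filled in with the limiting value `1`. -/
def thetaQuotient (α τ : ℂ) : ℂ → ℂ :=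
  Function.update
    (fun z : ℂ => z * thetaOneOne (z + α) τ * thetaOneOneDerivZero τ /
      (thetaOneOne z τ * thetaOneOne α τ)) 0 1

/-- The function `s_{a/l}^{(k)}` on the upper half plane: `(2πi)^{-k}` times the `k`-th derivative
at `z = 0` of `log (z θ(z + a/l) θ'(0) / (θ(z) θ(a/l)))`. The argument of the logarithm equals `1`
at `z = 0`, so near `0` the principal branch is the holomorphic one vanishing at `0`. -/
def sForm (l : ℕ) (a : ℤ) (k : ℕ) (τ : UpperHalfPlane) : ℂ :=
  ((2 * Real.pi * I : ℂ) ^ k)⁻¹ *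
    iteratedDeriv k
      (fun z : ℂ => Complex.log (thetaQuotient ((a : ℂ) / (l : ℂ)) (τ : ℂ) z)) 0

end

/-!
Fix `τ` and write `φ = θ' / θ` for the logarithmic derivative of theta in the elliptic variable
and `℘` for the Weierstrass function of the lattice `Λ = ℤ + ℤτ`.

*Reduction to elliptic functions.* Liouville's theorem for functions with a removable singularity
at the lattice points (`PeriodPair.eq_const_of_periodic`) shows that `θ` is a constant multiple of
an infinite product; the multiple is nonzero because `θ` has a nonzero Fourier coefficient
(`integral_jacobiTheta₂`), so the zeros of `θ` are exactly the points of `Λ` and they are simple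
(`thetaOneOne_zeros`). It also shows that `φ' = c - ℘` off `Λ` (`deriv_thetaLogDeriv`). Hence, up
to powers of `2πi`, `s⁽¹⁾` at `α = a / l` is `φ(α)`, and `s⁽ᵏ⁺²⁾` is `-℘⁽ᵏ⁾(α)` plus the `k`-th
derivative at `0` of `℘(z) - z⁻²` (`sForm_one`, `sForm_add_two`). The equation
`℘'' = 6℘² - g₂ / 2` turns all of these into polynomials in `φ(α)`, `℘(α)`, `℘'(α)` and `g₂`, the
invariant `g₃` being eliminated through the equation of the curve (`sForm_mem`).

*Addition formulas.* A third use of Liouville's theorem expresses `℘(y) - ℘(x)` by theta functions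
(`thetaOneOne_add_mul_sub`). With `Z = φ(x + y) - φ(x) - φ(y)`, logarithmic differentiation gives
`℘'(x) - ℘'(y) = 2 (℘(x) - ℘(y)) Z`. One more differentiation gives
`℘''(x) = 2 ℘'(x) Z + 2 (℘(x) - ℘(y)) (℘(x) - ℘(x + y))`, and together with the differential
equation this yields `Z² = ℘(x) + ℘(y) + ℘(x + y)`.

*Linear algebra at torsion points.* Modulo the algebra generated by the values of `φ`, the last
relation says that `X(a) = ℘(a / l)` satisfies `X(a) + X(b) + X(a + b) ≡ 0`. For `l ≥ 5` the pairs
`(1, 1)`, `(1, 2)`, `(1, 3)`, `(2, 2)` force `6 X(1) ≡ 0`; for `l = 3` the pair `(1, 1)` and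
evenness force `3 X(1) ≡ 0`. The formula for `℘'(x) - ℘'(y)` then deals with `℘'`, and the formula
for `℘''` with `x = y = 1 / l` deals with `g₂`. What these relations leave undetermined for
`l ≤ 4` is supplied by the additional generators: `℘(1 / 4)`, `℘'(1 / 3)`, or the pair `℘(1 / 2)`,
`g₂`. At a point of order two both `φ` and `℘'` vanish, being odd and periodic.
-/

noncomputable section

open Complex Filter Topology

/-! ### Elliptic functions with a removable singularity -/

/-- Liouville's theorem on a complex torus: a doubly periodic function that is holomorphic off the
lattice and has a removable singularity at the origin is constant. -/
lemma PeriodPair.eq_const_of_periodic (L : PeriodPair) {f g : ℂ → ℂ}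
    (hf : DifferentiableOn ℂ f (L.lattice : Set ℂ)ᶜ)
    (h₁ : ∀ z ∉ L.lattice, f (z + L.ω₁) = f z) (h₂ : ∀ z ∉ L.lattice, f (z + L.ω₂) = f z)
    (hg : AnalyticAt ℂ g 0) (hfg : f =ᶠ[𝓝[≠] 0] g) : ∀ z ∉ L.lattice, f z = g 0 := by
  classical
  -- `F` fills in the singularities of `f` with the value dictated by `g`.
  let F : ℂ → ℂ := fun z ↦ if z ∈ L.lattice then g 0 else f z
  have hadd (w : ℂ) (hw : w ∈ L.lattice) (z : ℂ) : z + w ∈ L.lattice ↔ z ∈ L.lattice :=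
    L.lattice.add_mem_iff_left hw
  have hper (w : ℂ) (hw : w ∈ L.lattice) : ∀ z, F (z + w) = F z := by
    let H : AddSubgroup ℂ :=
      { carrier := {w | ∀ z, F (z + w) = F z}
        zero_mem' := by simp
        add_mem' := fun {a b} ha hb z ↦ by rw [← add_assoc, hb, ha]
        neg_mem' := fun {a} ha z ↦ by rw [← ha (z + -a), neg_add_cancel_right] }
    have key (v : ℂ) (hv : v ∈ L.lattice) (h : ∀ z ∉ L.lattice, f (z + v) = f z) : v ∈ H := by
      intro z
      by_cases hz : z ∈ L.lattice
      · simp [F, hz, (hadd v hv z).2 hz]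
      · simp [F, hz, (hadd v hv z).not.2 hz, h z hz]
    obtain ⟨m, n, rfl⟩ := PeriodPair.mem_lattice.mp hw
    have := H.add_mem (H.zsmul_mem (key _ L.ω₁_mem_lattice h₁) m)
      (H.zsmul_mem (key _ L.ω₂_mem_lattice h₂) n)
    simp only [zsmul_eq_mul] at this
    exact this
  have hF0 : F =ᶠ[𝓝 0] g := by
    have h := eventually_nhdsWithin_iff.mp hfg
    filter_upwards [h, L.compl_lattice_sdiff_singleton_mem_nhds 0] with z hz hz'
    by_cases hz0 : z = 0
    · simp [F, hz0]
    · have : z ∉ L.lattice := by simp_all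
      simp [F, this, hz hz0]
  have hd : Differentiable ℂ F := by
    intro z
    by_cases hz : z ∈ L.lattice
    · have : DifferentiableAt ℂ F (z - z) := by
        rw [sub_self]; exact (hg.congr hF0.symm).differentiableAt
      have h2 := this.comp z (f := fun x ↦ x - z) (by fun_prop)
      refine h2.congr_of_eventuallyEq (.of_forall fun x ↦ ?_)
      simpa using (hper z hz (x - z))
    · have ho := L.isClosed_lattice.isOpen_compl.mem_nhds hz
      refine ((hf z hz).differentiableAt ho).congr_of_eventuallyEq ?_
      filter_upwards [ho] with x hx
      exact if_neg hx
  intro z hz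
  have := hd.apply_eq_apply_of_bounded (IsZLattice.isCompact_range_of_periodic L.lattice F
    hd.continuous fun z w hw ↦ hper w hw z).isBounded z 0
  simpa [F, hz] using this

/-- The difference quotient `z ↦ f z / z` of an entire function vanishing at `0` is entire. -/
lemma differentiable_dslope_zero {f : ℂ → ℂ} (hf : Differentiable ℂ f) :
    Differentiable ℂ (dslope f 0) := by
  rw [← differentiableOn_univ, Complex.differentiableOn_dslope (by simp)]
  exact hf.differentiableOn

lemma mul_dslope_zero {f : ℂ → ℂ} (h0 : f 0 = 0) (z : ℂ) : z * dslope f 0 z = f z := by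
  have := sub_smul_dslope f 0 z
  simpa [h0] using this

/-! ### The period lattice spanned by `1` and `τ` -/

/-- The pair of periods `(1, τ)`. -/
def UpperHalfPlane.periodPair (τ : UpperHalfPlane) : PeriodPair where
  ω₁ := 1
  ω₂ := τ
  indep := by
    rw [LinearIndependent.pair_iff]
    intro s t h
    have him := congrArg Complex.im h
    have hre := congrArg Complex.re h
    have ht : t = 0 := by simpa [τ.im_ne_zero] using him
    refine ⟨?_, ht⟩
    simpa [ht] using hre

namespace UpperHalfPlane

variable (τ : UpperHalfPlane)

@[simp] lemma periodPair_ω₁ : τ.periodPair.ω₁ = 1 := rfl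

@[simp] lemma periodPair_ω₂ : τ.periodPair.ω₂ = τ := rfl

lemma mem_periodPair_lattice {z : ℂ} :
    z ∈ τ.periodPair.lattice ↔ ∃ m n : ℤ, (m : ℂ) + n * τ = z := by
  simp [PeriodPair.mem_lattice]

lemma one_mem_lattice : (1 : ℂ) ∈ τ.periodPair.lattice := τ.periodPair.ω₁_mem_lattice

lemma coe_mem_lattice : (τ : ℂ) ∈ τ.periodPair.lattice := τ.periodPair.ω₂_mem_lattice

lemma intCast_mem_lattice (m : ℤ) : (m : ℂ) ∈ τ.periodPair.lattice :=
  τ.mem_periodPair_lattice.mpr ⟨m, 0, by simp⟩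

/-- A fraction lies in the lattice `ℤ + ℤτ` only if it is an integer. -/
lemma div_mem_lattice_iff {l : ℕ} (hl : l ≠ 0) (a : ℤ) :
    (a : ℂ) / l ∈ τ.periodPair.lattice ↔ (l : ℤ) ∣ a := by
  have hl' : (l : ℂ) ≠ 0 := by exact_mod_cast hl
  constructor
  · intro h
    obtain ⟨m, n, hmn⟩ := τ.mem_periodPair_lattice.mp h
    have hr : (a : ℂ) / l = ((a / l : ℝ) : ℂ) := by push_cast; rfl
    have him := congrArg Complex.im hmn
    rw [hr, Complex.ofReal_im] at him
    have hn : n = 0 := by simpa [τ.im_ne_zero] using him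
    subst hn
    rw [Int.cast_zero, zero_mul, add_zero, eq_div_iff hl'] at hmn
    exact ⟨m, by rw [mul_comm]; exact_mod_cast hmn.symm⟩
  · rintro ⟨c, rfl⟩
    have : (((l : ℤ) * c : ℤ) : ℂ) / l = (c : ℂ) := by
      push_cast; field_simp
    rw [this]
    exact τ.intCast_mem_lattice c

end UpperHalfPlane

/-! ### The infinite product with simple zeros on the lattice -/

/-- The infinite product `∏ (1 - qⁿ w)` over `n ≥ 0`. -/
def qProd (q w : ℂ) : ℂ := ∏' n : ℕ, (1 - q ^ n * w)

lemma summable_norm_pow_mul {q : ℂ} (hq : ‖q‖ < 1) (w : ℂ) :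
    Summable fun n : ℕ ↦ ‖-(q ^ n * w)‖ := by
  simpa using (summable_geometric_of_lt_one (norm_nonneg _) hq).mul_right ‖w‖

lemma qProd_eq_mul {q : ℂ} (hq : ‖q‖ < 1) (w : ℂ) : qProd q w = (1 - w) * qProd q (q * w) := by
  have h : Multipliable fun n : ℕ ↦ 1 - q ^ (n + 1) * w := by
    have := multipliable_one_add_of_summable (summable_norm_pow_mul hq (q * w))
    simpa only [pow_succ, mul_assoc, sub_eq_add_neg] using this
  have h' := tprod_eq_zero_mul' (f := fun n : ℕ ↦ 1 - q ^ n * w) h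
  simpa only [qProd, pow_succ, mul_assoc, pow_zero, one_mul] using h'

lemma qProd_ne_zero {q : ℂ} (hq : ‖q‖ < 1) {w : ℂ}
    (h : ∀ n : ℕ, q ^ n * w ≠ 1) : qProd q w ≠ 0 := by
  have := tprod_one_add_ne_zero_of_summable (f := fun n : ℕ ↦ -(q ^ n * w))
    (fun n h' ↦ h n (by linear_combination -h')) (summable_norm_pow_mul hq w)
  simpa [qProd, sub_eq_add_neg] using this

lemma differentiable_qProd {q : ℂ} (hq : ‖q‖ < 1) : Differentiable ℂ (qProd q) := by
  intro w
  have hu : Summable fun n : ℕ ↦ ‖q‖ ^ n * (‖w‖ + 1) :=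
    (summable_geometric_of_lt_one (norm_nonneg _) hq).mul_right _
  have := hu.hasProdLocallyUniformlyOn_nat_one_add (f := fun n x ↦ -(q ^ n * x))
    (Metric.isOpen_ball (x := (0 : ℂ)) (ε := ‖w‖ + 1))
    (.of_forall fun n x hx ↦ by
      rw [norm_neg, norm_mul, norm_pow]
      have : ‖x‖ ≤ ‖w‖ + 1 := by simpa using (mem_ball_zero_iff.mp hx).le
      gcongr) (fun n ↦ by fun_prop)
  have hd := TendstoLocallyUniformlyOn.differentiableOn this
    (.of_forall fun _ ↦ by simpa [Finset.prod_fn] using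
      DifferentiableOn.finsetProd (fun _ _ ↦ by fun_prop)) Metric.isOpen_ball
  have hd' : DifferentiableOn ℂ (qProd q) (Metric.ball 0 (‖w‖ + 1)) := by
    simpa [qProd, funext_iff, sub_eq_add_neg] using! hd
  exact hd'.differentiableAt (Metric.isOpen_ball.mem_nhds (by simp))

/-! ### The theta function and its zeros -/

/-- The product `e^{-πiz} ∏ (1 - qⁿ e^{2πiz}) ∏ (1 - qⁿ⁺¹ e^{-2πiz})` over `n ≥ 0`, with
`q = e^{2πiτ}`. It has the same quasi-periods as `θ`, and its zeros are visible. -/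
def thetaProd (τ : UpperHalfPlane) (z : ℂ) : ℂ :=
  cexp (-(Real.pi * I * z)) * (qProd (cexp (2 * Real.pi * I * τ)) (cexp (2 * Real.pi * I * z)) *
    qProd (cexp (2 * Real.pi * I * τ)) (cexp (2 * Real.pi * I * (τ - z))))

section Product

variable (τ : UpperHalfPlane)

lemma thetaProd_add_one (z : ℂ) : thetaProd τ (z + 1) = -thetaProd τ z := by
  have h1 : cexp (-(Real.pi * I * (z + 1))) = -cexp (-(Real.pi * I * z)) := by
    rw [show -(Real.pi * I * (z + 1)) = -(Real.pi * I * z) - Real.pi * I by ring, exp_sub_pi_mul_I]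
  have h2 : cexp (2 * Real.pi * I * (z + 1)) = cexp (2 * Real.pi * I * z) := by
    rw [mul_add, mul_one, Complex.exp_periodic]
  have h3 : cexp (2 * Real.pi * I * (τ - (z + 1))) = cexp (2 * Real.pi * I * (τ - z)) := by
    rw [← sub_sub, mul_sub _ _ (1 : ℂ), mul_one, Complex.exp_periodic.sub_eq]
  rw [thetaProd, h1, h2, h3, thetaProd]
  ring

lemma thetaProd_add_coe (z : ℂ) :
    thetaProd τ (z + τ) = -cexp (-(Real.pi * I * τ) - 2 * Real.pi * I * z) * thetaProd τ z := by
  have hq := τ.norm_exp_two_pi_I_lt_one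
  have e1 : cexp (2 * Real.pi * I * (z + τ)) =
      cexp (2 * Real.pi * I * τ) * cexp (2 * Real.pi * I * z) := by
    rw [← Complex.exp_add]; ring_nf
  have e2 : cexp (2 * Real.pi * I * (τ - (z + τ))) = cexp (-(2 * Real.pi * I * z)) := by ring_nf
  have e3 : cexp (2 * Real.pi * I * (τ - z)) =
      cexp (2 * Real.pi * I * τ) * cexp (-(2 * Real.pi * I * z)) := by
    rw [← Complex.exp_add]; ring_nf
  have e4 : cexp (-(Real.pi * I * (z + τ))) =
      cexp (-(Real.pi * I * z)) * cexp (-(Real.pi * I * τ)) := by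
    rw [← Complex.exp_add]; ring_nf
  have e5 : cexp (-(Real.pi * I * τ) - 2 * Real.pi * I * z) =
      cexp (-(Real.pi * I * τ)) * cexp (-(2 * Real.pi * I * z)) := by
    rw [← Complex.exp_add]; ring_nf
  have e6 : cexp (-(2 * Real.pi * I * z)) * cexp (2 * Real.pi * I * z) = 1 := by
    rw [← Complex.exp_add]; simp
  have w1 := qProd_eq_mul hq (cexp (2 * Real.pi * I * z))
  have w2 := qProd_eq_mul hq (cexp (-(2 * Real.pi * I * z)))
  rw [thetaProd, thetaProd, e1, e2, e3, e4, e5, w2, w1]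
  linear_combination (-cexp (-(Real.pi * I * z)) * cexp (-(Real.pi * I * τ)) *
    qProd (cexp (2 * Real.pi * I * τ)) (cexp (2 * Real.pi * I * τ) * cexp (2 * Real.pi * I * z)) *
    qProd (cexp (2 * Real.pi * I * τ))
      (cexp (2 * Real.pi * I * τ) * cexp (-(2 * Real.pi * I * z)))) * e6

/-- `q ^ n e^{2πiw} = 1` forces `w` to be a lattice point. -/
lemma exp_pow_mul_exp_ne_one {w : ℂ} (hw : w ∉ τ.periodPair.lattice) (n : ℕ) :
    cexp (2 * Real.pi * I * τ) ^ n * cexp (2 * Real.pi * I * w) ≠ 1 := by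
  rw [← Complex.exp_nat_mul, ← Complex.exp_add]
  intro h
  obtain ⟨m, hm⟩ := Complex.exp_eq_one_iff.mp h
  refine hw (τ.mem_periodPair_lattice.mpr ⟨m, -n, ?_⟩)
  have hpi : (2 * Real.pi * I : ℂ) ≠ 0 := Complex.two_pi_I_ne_zero
  refine mul_left_cancel₀ hpi ?_
  push_cast
  linear_combination -hm

lemma thetaProd_ne_zero {z : ℂ} (hz : z ∉ τ.periodPair.lattice) : thetaProd τ z ≠ 0 := by
  have hq := τ.norm_exp_two_pi_I_lt_one
  refine mul_ne_zero (Complex.exp_ne_zero _) (mul_ne_zero (qProd_ne_zero hq fun n ↦ ?_)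
    (qProd_ne_zero hq fun n ↦ ?_))
  · exact exp_pow_mul_exp_ne_one τ hz n
  · refine exp_pow_mul_exp_ne_one τ (fun h ↦ hz ?_) n
    simpa using τ.periodPair.lattice.sub_mem τ.coe_mem_lattice h

lemma differentiable_thetaProd : Differentiable ℂ (thetaProd τ) := by
  have h := differentiable_qProd τ.norm_exp_two_pi_I_lt_one
  unfold thetaProd
  fun_prop

lemma thetaProd_zero : thetaProd τ 0 = 0 := by
  have hq := τ.norm_exp_two_pi_I_lt_one
  have : qProd (cexp (2 * Real.pi * I * τ)) 1 = 0 := by rw [qProd_eq_mul hq]; simp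
  simp [thetaProd, this]

/-- The zero of the product at the origin is simple. -/
lemma deriv_thetaProd_zero_ne_zero : deriv (thetaProd τ) 0 ≠ 0 := by
  have hq := τ.norm_exp_two_pi_I_lt_one
  set q := cexp (2 * Real.pi * I * τ) with hqdef
  have hne : ∀ n : ℕ, q ^ n * q ≠ 1 := by
    intro n h
    have h' := congrArg norm h
    rw [← pow_succ, norm_pow, norm_one] at h'
    exact (pow_lt_one₀ (norm_nonneg _) hq n.succ_ne_zero).ne h'
  -- Split off the factor `1 - e^{2πiz}`, which carries the zero.
  let R : ℂ → ℂ := fun z ↦ cexp (-(Real.pi * I * z)) *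
    (qProd q (q * cexp (2 * Real.pi * I * z)) * qProd q (cexp (2 * Real.pi * I * (τ - z))))
  have hR : thetaProd τ = fun z ↦ (1 - cexp (2 * Real.pi * I * z)) * R z := by
    ext z
    rw [thetaProd, ← hqdef, qProd_eq_mul hq (cexp (2 * Real.pi * I * z))]
    ring
  have hRd : DifferentiableAt ℂ R 0 := by
    have h := differentiable_qProd hq
    have : Differentiable ℂ R := by fun_prop
    exact this 0
  have hR0 : R 0 ≠ 0 := by
    have h := qProd_ne_zero hq hne
    simpa [R, ← hqdef] using h
  have h1 : HasDerivAt (fun z : ℂ ↦ 1 - cexp (2 * Real.pi * I * z)) (-(2 * Real.pi * I)) 0 := by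
    have := (((hasDerivAt_id (0 : ℂ)).const_mul (2 * Real.pi * I : ℂ)).cexp).const_sub 1
    simpa using this
  rw [hR, (h1.fun_mul hRd.hasDerivAt).deriv]
  simpa using hR0

end Product

section Theta

variable (τ : UpperHalfPlane)

lemma thetaOneOne_eq_jacobiTheta₂ (z : ℂ) :
    thetaOneOne z τ = (1 / I) * (cexp (Real.pi * I * τ / 4 + Real.pi * I * z) *
      jacobiTheta₂ (z + 1 / 2 + τ / 2) τ) := by
  simp only [thetaOneOne, jacobiTheta₂, ← tsum_mul_left]
  refine tsum_congr fun n ↦ ?_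
  have h : ((-1 : ℂ)) ^ n = cexp (n * (Real.pi * I)) := by
    rw [Complex.exp_int_mul, Complex.exp_pi_mul_I]
  rw [h, jacobiTheta₂_term, ← Complex.exp_add, ← Complex.exp_add, ← Complex.exp_add]
  congr 2
  ring

lemma differentiable_thetaOneOne : Differentiable ℂ fun z ↦ thetaOneOne z τ := by
  have h : Differentiable ℂ (jacobiTheta₂ · (τ : ℂ)) := fun z ↦
    differentiableAt_jacobiTheta₂_fst z τ.im_pos
  simp only [thetaOneOne_eq_jacobiTheta₂]
  have h' : Differentiable ℂ fun z : ℂ ↦ jacobiTheta₂ (z + 1 / 2 + τ / 2) τ :=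
    h.comp (g := (jacobiTheta₂ · (τ : ℂ))) (f := fun z : ℂ ↦ z + 1 / 2 + τ / 2) (by fun_prop)
  fun_prop

lemma thetaOneOne_add_one (z : ℂ) : thetaOneOne (z + 1) τ = -thetaOneOne z τ := by
  rw [thetaOneOne_eq_jacobiTheta₂, thetaOneOne_eq_jacobiTheta₂,
    show z + 1 + 1 / 2 + (τ : ℂ) / 2 = (z + 1 / 2 + τ / 2) + 1 by ring, jacobiTheta₂_add_left,
    show Real.pi * I * τ / 4 + Real.pi * I * (z + 1) =
      (Real.pi * I * τ / 4 + Real.pi * I * z) + Real.pi * I by ring, exp_add_pi_mul_I]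
  ring

lemma thetaOneOne_add_coe (z : ℂ) : thetaOneOne (z + τ) τ =
    -cexp (-(Real.pi * I * τ) - 2 * Real.pi * I * z) * thetaOneOne z τ := by
  rw [thetaOneOne_eq_jacobiTheta₂, thetaOneOne_eq_jacobiTheta₂,
    show z + τ + 1 / 2 + (τ : ℂ) / 2 = (z + 1 / 2 + τ / 2) + τ by ring, jacobiTheta₂_add_left']
  have h : cexp (Real.pi * I * τ / 4 + Real.pi * I * (z + τ)) *
      cexp (-Real.pi * I * (τ + 2 * (z + 1 / 2 + τ / 2))) =
      -(cexp (-(Real.pi * I * τ) - 2 * Real.pi * I * z) *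
        cexp (Real.pi * I * τ / 4 + Real.pi * I * z)) := by
    rw [← Complex.exp_add, ← Complex.exp_add, ← exp_sub_pi_mul_I]
    ring_nf
  linear_combination (1 / I) * jacobiTheta₂ (z + 1 / 2 + τ / 2) τ * h

lemma thetaOneOne_neg (z : ℂ) : thetaOneOne (-z) τ = -thetaOneOne z τ := by
  rw [thetaOneOne_eq_jacobiTheta₂, thetaOneOne_eq_jacobiTheta₂, ← jacobiTheta₂_neg_left,
    show -(-z + 1 / 2 + (τ : ℂ) / 2) = z - 1 / 2 - τ / 2 by ring]
  have h := jacobiTheta₂_add_left' (z - 1 / 2 - τ / 2) τ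
  have h2 := jacobiTheta₂_add_left (z - 1 / 2 + τ / 2) τ
  rw [show z - 1 / 2 - (τ : ℂ) / 2 + τ = z - 1 / 2 + τ / 2 by ring] at h
  rw [show z - 1 / 2 + (τ : ℂ) / 2 + 1 = z + 1 / 2 + τ / 2 by ring, h] at h2
  rw [h2]
  have h3 : cexp (Real.pi * I * τ / 4 + Real.pi * I * z) *
      cexp (-Real.pi * I * (τ + 2 * (z - 1 / 2 - τ / 2))) =
      -cexp (Real.pi * I * τ / 4 + Real.pi * I * (-z)) := by
    rw [← Complex.exp_add, ← exp_add_pi_mul_I]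
    ring_nf
  linear_combination (1 / I) * jacobiTheta₂ (z - 1 / 2 - τ / 2) τ * h3

@[simp] lemma thetaOneOne_zero : thetaOneOne 0 τ = 0 := by
  rw [← CharZero.eq_neg_self_iff, ← thetaOneOne_neg, neg_zero]

/-- The constant Fourier coefficient of the Jacobi theta function is `1`. -/
lemma integral_jacobiTheta₂ : ∫ x in (0 : ℝ)..1, jacobiTheta₂ x τ = 1 := by
  have hnorm (n : ℤ) (x : ℝ) : ‖jacobiTheta₂_term n x τ‖ = ‖jacobiTheta₂_term n 0 τ‖ := by
    simp [norm_jacobiTheta₂_term]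
  have h := intervalIntegral.hasSum_integral_of_dominated_convergence (μ := MeasureTheory.volume)
    (a := 0) (b := 1) (F := fun (n : ℤ) (x : ℝ) ↦ jacobiTheta₂_term n x τ)
    (f := fun x : ℝ ↦ jacobiTheta₂ x τ) (fun n _ ↦ ‖jacobiTheta₂_term n 0 τ‖)
    (fun n ↦ by
      have : Continuous fun x : ℝ ↦ jacobiTheta₂_term n x τ := by
        unfold jacobiTheta₂_term; fun_prop
      exact this.aestronglyMeasurable)
    (fun n ↦ .of_forall fun x _ ↦ (hnorm n x).le)
    (.of_forall fun x _ ↦ ((summable_jacobiTheta₂_term_iff 0 τ).mpr τ.im_pos).norm)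
    intervalIntegrable_const
    (.of_forall fun x _ ↦ hasSum_jacobiTheta₂_term x τ.im_pos)
  have hzero (n : ℤ) (hn : n ≠ 0) : ∫ x in (0 : ℝ)..1, jacobiTheta₂_term n x τ = 0 := by
    have hc : (2 * Real.pi * I * n : ℂ) ≠ 0 :=
      mul_ne_zero Complex.two_pi_I_ne_zero (by exact_mod_cast hn)
    simp only [jacobiTheta₂_term, Complex.exp_add]
    rw [intervalIntegral.integral_mul_const, integral_exp_mul_complex hc]
    have : cexp (2 * Real.pi * I * n) = 1 := by
      rw [mul_comm]; exact Complex.exp_int_mul_two_pi_mul_I n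
    simp [this]
  have h2 := hasSum_single (f := fun n : ℤ ↦ ∫ x in (0 : ℝ)..1, jacobiTheta₂_term n x τ) 0
    (fun n hn ↦ hzero n hn)
  rw [h.unique h2]
  simp [jacobiTheta₂_term]

lemma exists_thetaOneOne_ne_zero : ∃ z, thetaOneOne z τ ≠ 0 := by
  by_contra! h
  have h0 (w : ℂ) : jacobiTheta₂ w τ = 0 := by
    have := h (w - 1 / 2 - τ / 2)
    rw [thetaOneOne_eq_jacobiTheta₂,
      show w - 1 / 2 - (τ : ℂ) / 2 + 1 / 2 + τ / 2 = w by ring] at this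
    simpa using this
  have := integral_jacobiTheta₂ τ
  simp [h0] at this

/-- The zeros of `θ` are exactly the lattice points, and they are simple: by Liouville, `θ` is a
nonzero multiple of the infinite product `thetaProd`. -/
lemma thetaOneOne_zeros : (∀ z ∉ τ.periodPair.lattice, thetaOneOne z τ ≠ 0) ∧
    thetaOneOneDerivZero τ ≠ 0 := by
  set L := τ.periodPair
  have hP := differentiable_thetaProd τ
  have hθ := differentiable_thetaOneOne τ
  have hg : AnalyticAt ℂ (fun z ↦ dslope (fun z ↦ thetaOneOne z τ) 0 z /
      dslope (thetaProd τ) 0 z) 0 :=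
    ((differentiable_dslope_zero hθ).analyticAt 0).div
      ((differentiable_dslope_zero hP).analyticAt 0) (by simpa using deriv_thetaProd_zero_ne_zero τ)
  have hconst := L.eq_const_of_periodic (f := fun z ↦ thetaOneOne z τ / thetaProd τ z)
    (fun z hz ↦ ((hθ z).div (hP z) (thetaProd_ne_zero τ hz)).differentiableWithinAt)
    (fun z _ ↦ by
      change thetaOneOne (z + 1) τ / thetaProd τ (z + 1) = _
      rw [thetaOneOne_add_one, thetaProd_add_one, neg_div_neg_eq])
    (fun z _ ↦ by
      change thetaOneOne (z + τ) τ / thetaProd τ (z + τ) = _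
      rw [thetaOneOne_add_coe, thetaProd_add_coe,
        mul_div_mul_left _ _ (neg_ne_zero.mpr (Complex.exp_ne_zero _))])
    hg (by
      filter_upwards [self_mem_nhdsWithin] with z hz
      rw [← mul_dslope_zero (f := fun z ↦ thetaOneOne z τ) (thetaOneOne_zero τ) z,
        ← mul_dslope_zero (thetaProd_zero τ) z, mul_div_mul_left _ _ hz])
  set c := dslope (fun z ↦ thetaOneOne z τ) 0 0 / dslope (thetaProd τ) 0 0 with hc
  have hmul (z : ℂ) (hz : z ∉ L.lattice) : thetaOneOne z τ = c * thetaProd τ z := by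
    rw [← hconst z hz, div_mul_cancel₀ _ (thetaProd_ne_zero τ hz)]
  have hc0 : c ≠ 0 := by
    intro hc0
    obtain ⟨w, hw⟩ := exists_thetaOneOne_ne_zero τ
    have hhalf : L.ω₁ / 2 ∉ L.lattice := L.ω₁_div_two_notMem_lattice
    have hev : (fun z ↦ thetaOneOne z τ) =ᶠ[𝓝 (L.ω₁ / 2)] fun _ ↦ 0 := by
      filter_upwards [L.isClosed_lattice.isOpen_compl.mem_nhds hhalf] with z hz
      rw [hmul z hz, hc0, zero_mul]
    have := AnalyticOnNhd.eq_of_eventuallyEq (fun z _ ↦ hθ.analyticAt z)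
      (fun z _ ↦ analyticAt_const) hev
    exact hw (congrFun this w)
  refine ⟨fun z hz ↦ ?_, ?_⟩
  · rw [hmul z hz]
    exact mul_ne_zero hc0 (thetaProd_ne_zero τ hz)
  · intro h
    refine hc0 ?_
    rw [hc, dslope_same]
    rw [thetaOneOneDerivZero] at h
    rw [h, zero_div]

end Theta

/-! ### The logarithmic derivative of theta and the Weierstrass function -/

namespace UpperHalfPlane

variable (τ : UpperHalfPlane)

lemma thetaOneOne_ne_zero {z : ℂ} (hz : z ∉ τ.periodPair.lattice) : thetaOneOne z τ ≠ 0 :=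
  (thetaOneOne_zeros τ).1 z hz

/-- The entire function `θ(z) / z`. -/
def thetaReg : ℂ → ℂ := dslope (fun z ↦ thetaOneOne z τ) 0

/-- The logarithmic derivative `θ' / θ` in the elliptic variable. -/
def thetaLogDeriv : ℂ → ℂ := logDeriv fun z ↦ thetaOneOne z τ

/-- The constant `c` with `(θ' / θ)' = c - ℘`. -/
def thetaConst : ℂ := deriv (logDeriv τ.thetaReg) 0

lemma differentiable_thetaReg : Differentiable ℂ τ.thetaReg :=
  differentiable_dslope_zero (differentiable_thetaOneOne τ)

lemma mul_thetaReg (z : ℂ) : z * τ.thetaReg z = thetaOneOne z τ :=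
  mul_dslope_zero (f := fun z ↦ thetaOneOne z τ) (thetaOneOne_zero τ) z

lemma thetaReg_zero : τ.thetaReg 0 = thetaOneOneDerivZero τ := dslope_same _ _

lemma thetaReg_zero_ne_zero : τ.thetaReg 0 ≠ 0 := by
  rw [thetaReg_zero]; exact (thetaOneOne_zeros τ).2

lemma thetaReg_neg (z : ℂ) : τ.thetaReg (-z) = τ.thetaReg z := by
  rcases eq_or_ne z 0 with rfl | hz
  · simp
  · refine mul_left_cancel₀ hz ?_
    have := τ.mul_thetaReg (-z)
    rw [thetaOneOne_neg, ← τ.mul_thetaReg z] at this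
    linear_combination -this

lemma ne_zero_of_notMem_lattice {z : ℂ} (hz : z ∉ τ.periodPair.lattice) : z ≠ 0 := by
  rintro rfl
  exact hz (zero_mem _)

lemma eventually_notMem_lattice (x : ℂ) : ∀ᶠ z in 𝓝[≠] x, z ∉ τ.periodPair.lattice := by
  filter_upwards [self_mem_nhdsWithin, mem_nhdsWithin_of_mem_nhds
    (τ.periodPair.compl_lattice_sdiff_singleton_mem_nhds x)] with z hz hz'
  simp_all

lemma lattice_compl_mem_nhds {x : ℂ} (hx : x ∉ τ.periodPair.lattice) :
    (τ.periodPair.lattice : Set ℂ)ᶜ ∈ 𝓝 x :=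
  τ.periodPair.isClosed_lattice.isOpen_compl.mem_nhds hx

lemma thetaReg_ne_zero {z : ℂ} (hz : z ∉ τ.periodPair.lattice) : τ.thetaReg z ≠ 0 := by
  intro h
  refine τ.thetaOneOne_ne_zero hz ?_
  rw [← mul_thetaReg, h, mul_zero]

lemma analyticAt_logDeriv_thetaReg : AnalyticAt ℂ (logDeriv τ.thetaReg) 0 :=
  (τ.differentiable_thetaReg.analyticAt 0).deriv.div (τ.differentiable_thetaReg.analyticAt 0)
    τ.thetaReg_zero_ne_zero

lemma logDeriv_thetaReg_zero : logDeriv τ.thetaReg 0 = 0 := by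
  have h : deriv τ.thetaReg 0 = -deriv τ.thetaReg 0 := by
    conv_lhs => rw [show τ.thetaReg = fun z ↦ τ.thetaReg (-z) from funext fun z ↦
      (τ.thetaReg_neg z).symm]
    rw [deriv_comp_neg, neg_zero]
  rw [logDeriv_apply, CharZero.eq_neg_self_iff.mp h, zero_div]

lemma thetaLogDeriv_eq {z : ℂ} (hz : z ∉ τ.periodPair.lattice) :
    τ.thetaLogDeriv z = 1 / z + logDeriv τ.thetaReg z := by
  rw [thetaLogDeriv, show (fun z ↦ thetaOneOne z τ) = fun z ↦ id z * τ.thetaReg z from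
    funext fun z ↦ (τ.mul_thetaReg z).symm, logDeriv_mul z (τ.ne_zero_of_notMem_lattice hz)
    (τ.thetaReg_ne_zero hz) differentiableAt_id (τ.differentiable_thetaReg z), logDeriv_id]

lemma thetaLogDeriv_neg (z : ℂ) : τ.thetaLogDeriv (-z) = -τ.thetaLogDeriv z := by
  have h : deriv (fun z ↦ thetaOneOne z τ) (-z) = deriv (fun z ↦ thetaOneOne z τ) z := by
    have h1 := deriv_comp_neg (fun z ↦ thetaOneOne z τ) z
    simp only [thetaOneOne_neg, deriv.fun_neg] at h1
    linear_combination h1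
  simp only [thetaLogDeriv, logDeriv_apply, h, thetaOneOne_neg, div_neg]

lemma thetaLogDeriv_add_one (z : ℂ) : τ.thetaLogDeriv (z + 1) = τ.thetaLogDeriv z := by
  have h1 := deriv_comp_add_const (fun z ↦ thetaOneOne z τ) 1 z
  simp only [thetaOneOne_add_one, deriv.fun_neg] at h1
  simp only [thetaLogDeriv, logDeriv_apply, thetaOneOne_add_one, ← h1, neg_div_neg_eq]

lemma thetaLogDeriv_add_coe {z : ℂ} (hz : z ∉ τ.periodPair.lattice) :
    τ.thetaLogDeriv (z + τ) = τ.thetaLogDeriv z - 2 * Real.pi * Complex.I := by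
  have h1 := deriv_comp_add_const (fun z ↦ thetaOneOne z τ) τ z
  have he : HasDerivAt
      (fun z : ℂ ↦ -cexp (-(Real.pi * Complex.I * τ) - 2 * Real.pi * Complex.I * z))
      (2 * Real.pi * Complex.I *
        cexp (-(Real.pi * Complex.I * τ) - 2 * Real.pi * Complex.I * z)) z := by
    have := (((hasDerivAt_id z).const_mul (2 * Real.pi * Complex.I : ℂ)).const_sub
      (-(Real.pi * Complex.I * τ : ℂ))).cexp.fun_neg
    convert! this using 1
    simp
    ring
  simp only [thetaOneOne_add_coe] at h1
  rw [(he.fun_mul (differentiable_thetaOneOne τ z).hasDerivAt).deriv] at h1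
  simp only [thetaLogDeriv, logDeriv_apply, thetaOneOne_add_coe, ← h1]
  have := τ.thetaOneOne_ne_zero hz
  have := Complex.exp_ne_zero (-(Real.pi * Complex.I * τ) - 2 * Real.pi * Complex.I * z)
  field_simp
  ring

lemma thetaLogDeriv_add_intCast (z : ℂ) (n : ℤ) :
    τ.thetaLogDeriv (z + n) = τ.thetaLogDeriv z := by
  have h : Function.Periodic τ.thetaLogDeriv 1 := τ.thetaLogDeriv_add_one
  simpa using h.int_mul n z

lemma analyticAt_thetaLogDeriv {z : ℂ} (hz : z ∉ τ.periodPair.lattice) :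
    AnalyticAt ℂ τ.thetaLogDeriv z :=
  ((differentiable_thetaOneOne τ).analyticAt z).deriv.div
    ((differentiable_thetaOneOne τ).analyticAt z) (τ.thetaOneOne_ne_zero hz)

open PeriodPair in
/-- The regular part of `℘` at the origin. The identity persists at `z = 0`, where `℘` and
`1 / z ^ 2` both take the junk value `0`. -/
lemma weierstrassPExcept_zero_eq (z : ℂ) : ℘[τ.periodPair - (0 : ℂ)] z =
    ℘[τ.periodPair] z - 1 / z ^ 2 := by
  have := τ.periodPair.weierstrassPExcept_add 0 z
  simp only [ZeroMemClass.coe_zero] at this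
  rw [← this]
  simp

/-- `(θ' / θ)' + ℘` has no singularity at the origin, since `θ' / θ` has residue `1` there. -/
lemma deriv_thetaLogDeriv_eventuallyEq : deriv τ.thetaLogDeriv =ᶠ[𝓝[≠] 0]
    fun z ↦ deriv (logDeriv τ.thetaReg) z - 1 / z ^ 2 := by
  filter_upwards [τ.eventually_notMem_lattice 0, mem_nhdsWithin_of_mem_nhds
    τ.analyticAt_logDeriv_thetaReg.eventually_analyticAt] with z hz hz'
  have h0 := τ.ne_zero_of_notMem_lattice hz
  have : τ.thetaLogDeriv =ᶠ[𝓝 z] fun z ↦ 1 / z + logDeriv τ.thetaReg z := by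
    filter_upwards [τ.lattice_compl_mem_nhds hz] with w hw using τ.thetaLogDeriv_eq hw
  rw [this.deriv_eq]
  have h1 : HasDerivAt (fun z : ℂ ↦ 1 / z) (-(1 / z ^ 2)) z := by
    simpa [one_div] using! hasDerivAt_inv h0
  rw [(h1.fun_add hz'.differentiableAt.hasDerivAt).deriv]
  ring

lemma deriv_thetaLogDeriv {z : ℂ} (hz : z ∉ τ.periodPair.lattice) :
    deriv τ.thetaLogDeriv z = τ.thetaConst - τ.periodPair.weierstrassP z := by
  have key := τ.periodPair.eq_const_of_periodic
    (f := fun z ↦ deriv τ.thetaLogDeriv z + τ.periodPair.weierstrassP z)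
    (g := fun z ↦ deriv (logDeriv τ.thetaReg) z + τ.periodPair.weierstrassPExcept 0 z)
    (fun z hz ↦ ((τ.analyticAt_thetaLogDeriv hz).deriv.differentiableAt.add
      (τ.periodPair.analyticOnNhd_weierstrassP z hz).differentiableAt).differentiableWithinAt)
    (fun z hz ↦ by
      simp only [periodPair_ω₁]
      rw [← deriv_comp_add_const, τ.periodPair.weierstrassP_add_coe z ⟨1, τ.one_mem_lattice⟩]
      simp only [thetaLogDeriv_add_one])
    (fun z hz ↦ by
      simp only [periodPair_ω₂]
      rw [← deriv_comp_add_const, τ.periodPair.weierstrassP_add_coe z ⟨τ, τ.coe_mem_lattice⟩]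
      congr 1
      have : (fun x ↦ τ.thetaLogDeriv (x + τ)) =ᶠ[𝓝 z]
          fun x ↦ τ.thetaLogDeriv x - 2 * Real.pi * Complex.I := by
        filter_upwards [τ.lattice_compl_mem_nhds hz] with w hw using τ.thetaLogDeriv_add_coe hw
      rw [this.deriv_eq, deriv_sub_const])
    (τ.analyticAt_logDeriv_thetaReg.deriv.add (τ.periodPair.analyticAt_weierstrassPExcept 0))
    (by
      filter_upwards [τ.deriv_thetaLogDeriv_eventuallyEq] with z hz
      rw [hz, weierstrassPExcept_zero_eq]
      ring)
    z hz
  simp only [PeriodPair.weierstrassPExcept_zero, add_zero] at key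
  rw [thetaConst, ← key]
  ring

lemma hasDerivAt_thetaLogDeriv {z : ℂ} (hz : z ∉ τ.periodPair.lattice) :
    HasDerivAt τ.thetaLogDeriv (τ.thetaConst - τ.periodPair.weierstrassP z) z := by
  rw [← τ.deriv_thetaLogDeriv hz]
  exact (τ.analyticAt_thetaLogDeriv hz).differentiableAt.hasDerivAt

lemma deriv_logDeriv_thetaReg_eventuallyEq : deriv (logDeriv τ.thetaReg) =ᶠ[𝓝 0]
    fun z ↦ τ.thetaConst - τ.periodPair.weierstrassPExcept 0 z := by
  have h : ∀ᶠ z in 𝓝[≠] (0 : ℂ), deriv (logDeriv τ.thetaReg) z =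
      τ.thetaConst - τ.periodPair.weierstrassPExcept 0 z := by
    filter_upwards [τ.deriv_thetaLogDeriv_eventuallyEq, τ.eventually_notMem_lattice 0] with z hz hz'
    rw [τ.deriv_thetaLogDeriv hz'] at hz
    rw [weierstrassPExcept_zero_eq]
    linear_combination -hz
  filter_upwards [eventually_nhdsWithin_iff.mp h] with z hz
  rcases eq_or_ne z 0 with rfl | h0
  · simp [thetaConst]
  · exact hz h0

/-! ### Addition formulas -/

/-- `℘(y) - ℘(x)` as a quotient of theta functions. The quotient `θ(x + y) θ(x - y) / θ(x)²` has
poles at lattice points only, which is what makes Liouville's theorem immediately applicable. -/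
lemma thetaOneOne_add_mul_sub {x y : ℂ} (hx : x ∉ τ.periodPair.lattice)
    (hy : y ∉ τ.periodPair.lattice) :
    thetaOneOne (x + y) τ * thetaOneOne (x - y) τ * τ.thetaReg 0 ^ 2 =
      thetaOneOne x τ ^ 2 * thetaOneOne y τ ^ 2 *
        (τ.periodPair.weierstrassP y - τ.periodPair.weierstrassP x) := by
  have hθ := differentiable_thetaOneOne τ
  have hD0 := τ.thetaReg_zero_ne_zero
  set K := thetaOneOne y τ ^ 2 / τ.thetaReg 0 ^ 2 with hK
  let N : ℂ → ℂ := fun x ↦ thetaOneOne (x + y) τ * thetaOneOne (x - y) τ / τ.thetaReg x ^ 2 + K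
  have hN : AnalyticAt ℂ N 0 := by
    have h1 : Differentiable ℂ fun x ↦ thetaOneOne (x + y) τ :=
      hθ.comp (f := fun x ↦ x + y) (by fun_prop)
    have h2 : Differentiable ℂ fun x ↦ thetaOneOne (x - y) τ :=
      hθ.comp (f := fun x ↦ x - y) (by fun_prop)
    exact (((h1.analyticAt 0).mul (h2.analyticAt 0)).div
      ((τ.differentiable_thetaReg.analyticAt 0).pow 2) (pow_ne_zero 2 hD0)).add analyticAt_const
  -- `N` is even and vanishes at the origin, hence vanishes there to second order.
  have hN0 : N 0 = 0 := by
    simp only [N, hK, zero_add, zero_sub, thetaOneOne_neg]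
    ring
  have hNneg (x : ℂ) : N (-x) = N x := by
    simp only [N, τ.thetaReg_neg, show -x + y = -(x - y) by ring,
      show -x - y = -(x + y) by ring, thetaOneOne_neg]
    ring
  have hN1 : dslope N 0 0 = 0 := by
    have h : deriv N 0 = -deriv N 0 := by
      conv_lhs => rw [show N = fun z ↦ N (-z) from funext fun z ↦ (hNneg z).symm]
      rw [deriv_comp_neg, neg_zero]
    rw [dslope_same, CharZero.eq_neg_self_iff.mp h]
  have hdd : AnalyticAt ℂ (dslope (dslope N 0) 0) 0 := by
    obtain ⟨p, hp⟩ := hN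
    exact ⟨_, hp.has_fpower_series_dslope_fslope.has_fpower_series_dslope_fslope⟩
  have key := τ.periodPair.eq_const_of_periodic
    (f := fun x ↦ thetaOneOne (x + y) τ * thetaOneOne (x - y) τ / thetaOneOne x τ ^ 2 +
      K * τ.periodPair.weierstrassP x)
    (g := fun x ↦ dslope (dslope N 0) 0 x + K * τ.periodPair.weierstrassPExcept 0 x)
    (fun z hz ↦ by
      have h1 : DifferentiableAt ℂ (fun x ↦ thetaOneOne (x + y) τ) z :=
        (hθ (z + y)).comp z (f := fun x ↦ x + y) (by fun_prop)
      have h2 : DifferentiableAt ℂ (fun x ↦ thetaOneOne (x - y) τ) z :=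
        (hθ (z - y)).comp z (f := fun x ↦ x - y) (by fun_prop)
      exact (((h1.mul h2).div ((hθ z).pow 2) (pow_ne_zero 2 (τ.thetaOneOne_ne_zero hz))).add
        ((τ.periodPair.analyticOnNhd_weierstrassP z hz).differentiableAt.const_mul
          K)).differentiableWithinAt)
    (fun z hz ↦ by
      simp only [periodPair_ω₁, τ.periodPair.weierstrassP_add_coe z ⟨1, τ.one_mem_lattice⟩,
        show z + 1 + y = z + y + 1 by ring, show z + 1 - y = z - y + 1 by ring,
        thetaOneOne_add_one, neg_mul_neg, neg_sq])
    (fun z hz ↦ by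
      simp only [periodPair_ω₂, τ.periodPair.weierstrassP_add_coe z ⟨τ, τ.coe_mem_lattice⟩,
        show z + τ + y = z + y + τ by ring, show z + τ - y = z - y + τ by ring,
        thetaOneOne_add_coe]
      congr 1
      have he : cexp (-(Real.pi * Complex.I * τ) - 2 * Real.pi * Complex.I * (z + y)) *
          cexp (-(Real.pi * Complex.I * τ) - 2 * Real.pi * Complex.I * (z - y)) =
          cexp (-(Real.pi * Complex.I * τ) - 2 * Real.pi * Complex.I * z) ^ 2 := by
        rw [← Complex.exp_add, ← Complex.exp_nat_mul]
        congr 1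
        push_cast
        ring
      rw [mul_pow, neg_sq, mul_mul_mul_comm, neg_mul_neg, he,
        mul_div_mul_left _ _ (pow_ne_zero 2 (Complex.exp_ne_zero _))])
    (hdd.add (analyticAt_const.mul (τ.periodPair.analyticAt_weierstrassPExcept 0)))
    (by
      filter_upwards [τ.eventually_notMem_lattice 0] with z hz
      have hz0 := τ.ne_zero_of_notMem_lattice hz
      have h1 := mul_dslope_zero hN0 z
      rw [← mul_dslope_zero hN1 z] at h1
      rw [weierstrassPExcept_zero_eq, ← τ.mul_thetaReg z]
      have h2 : thetaOneOne (z + y) τ * thetaOneOne (z - y) τ / τ.thetaReg z ^ 2 =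
          z * (z * dslope (dslope N 0) 0 z) - K := by
        rw [h1]; simp only [N]; ring
      rw [mul_pow, mul_comm (z ^ 2), ← div_div, h2]
      field_simp
      ring)
  have hxy := (key x hx).trans (key y hy).symm
  simp only [sub_self, thetaOneOne_zero, mul_zero, zero_div, zero_add] at hxy
  have := τ.thetaOneOne_ne_zero hx
  rw [hK] at hxy
  field_simp at hxy
  linear_combination hxy

variable {τ}

lemma weierstrassP_ne {x y : ℂ} (hx : x ∉ τ.periodPair.lattice) (hy : y ∉ τ.periodPair.lattice)
    (h₁ : x + y ∉ τ.periodPair.lattice) (h₂ : x - y ∉ τ.periodPair.lattice) :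
    τ.periodPair.weierstrassP x ≠ τ.periodPair.weierstrassP y := by
  intro h
  have := τ.thetaOneOne_add_mul_sub hx hy
  rw [h, sub_self, mul_zero] at this
  exact mul_ne_zero (mul_ne_zero (τ.thetaOneOne_ne_zero h₁) (τ.thetaOneOne_ne_zero h₂))
    (pow_ne_zero 2 τ.thetaReg_zero_ne_zero) this

lemma eventually_weierstrassP_ne {x : ℂ} (hx : x ∉ τ.periodPair.lattice) :
    ∀ᶠ y in 𝓝[≠] x, τ.periodPair.weierstrassP y ≠ τ.periodPair.weierstrassP x := by
  have hshift (c : ℂ) : ∀ᶠ y in 𝓝[≠] x, y + c ∉ τ.periodPair.lattice := by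
    have ht : Tendsto (fun y ↦ y + c) (𝓝[≠] x) (𝓝[≠] (x + c)) := by
      refine tendsto_nhdsWithin_of_tendsto_nhds_of_eventually_within _
        ((by fun_prop : Continuous fun y : ℂ ↦ y + c).tendsto' x _ rfl |>.mono_left
          nhdsWithin_le_nhds) ?_
      filter_upwards [self_mem_nhdsWithin] with y hy
      simpa using hy
    exact ht.eventually (τ.eventually_notMem_lattice (x + c))
  filter_upwards [τ.eventually_notMem_lattice x, hshift x, hshift (-x)] with y h1 h2 h3
  exact weierstrassP_ne h1 hx h2 (by rwa [sub_eq_add_neg])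

lemma hasDerivAt_weierstrassP {x : ℂ} (hx : x ∉ τ.periodPair.lattice) :
    HasDerivAt τ.periodPair.weierstrassP (τ.periodPair.derivWeierstrassP x) x := by
  rw [← τ.periodPair.deriv_weierstrassP]
  exact (τ.periodPair.analyticOnNhd_weierstrassP x hx).differentiableAt.hasDerivAt

/-- The second-order differential equation `℘'' = 6℘² - g₂ / 2`. -/
lemma deriv_derivWeierstrassP {x : ℂ} (hx : x ∉ τ.periodPair.lattice) :
    deriv τ.periodPair.derivWeierstrassP x =
      6 * τ.periodPair.weierstrassP x ^ 2 - τ.periodPair.g₂ / 2 := by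
  set L := τ.periodPair
  have hdiff {z : ℂ} (hz : z ∉ L.lattice) : HasDerivAt L.derivWeierstrassP
      (deriv L.derivWeierstrassP z) z :=
    (L.analyticOnNhd_derivWeierstrassP z hz).differentiableAt.hasDerivAt
  -- Differentiating the first-order equation gives the claim after multiplication by `℘'`.
  have hmul {z : ℂ} (hz : z ∉ L.lattice) : L.derivWeierstrassP z *
      (deriv L.derivWeierstrassP z - (6 * L.weierstrassP z ^ 2 - L.g₂ / 2)) = 0 := by
    have h1 := (hdiff hz).fun_pow 2
    have hP := hasDerivAt_weierstrassP hz
    have h2 := (((hP.fun_pow 3).const_mul 4).fun_sub (hP.const_mul L.g₂)).sub_const L.g₃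
    have he : (fun z ↦ L.derivWeierstrassP z ^ 2) =ᶠ[𝓝 z]
        fun z ↦ 4 * L.weierstrassP z ^ 3 - L.g₂ * L.weierstrassP z - L.g₃ := by
      filter_upwards [τ.lattice_compl_mem_nhds hz] with w hw using L.derivWeierstrassP_sq w hw
    have := h1.unique (h2.congr_of_eventuallyEq he)
    push_cast at this
    linear_combination this / 2
  by_contra hne
  -- Otherwise `℘'` would vanish near `x`, although `℘` is not locally constant.
  have hcont : ContinuousAt (fun z ↦ deriv L.derivWeierstrassP z -
      (6 * L.weierstrassP z ^ 2 - L.g₂ / 2)) x := by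
    have h1 := (L.analyticOnNhd_derivWeierstrassP x hx).deriv.continuousAt
    have h2 := (L.analyticOnNhd_weierstrassP x hx).continuousAt
    fun_prop
  have hev : ∀ᶠ z in 𝓝 x, z ∉ L.lattice ∧ L.derivWeierstrassP z = 0 := by
    filter_upwards [hcont.eventually_ne (sub_ne_zero.mpr hne), τ.lattice_compl_mem_nhds hx]
      with z h1 h2
    exact ⟨h2, (mul_eq_zero.mp (hmul h2)).resolve_right h1⟩
  obtain ⟨ε, hε, hball⟩ := Metric.eventually_nhds_iff_ball.mp hev
  have hconst : ∀ z ∈ Metric.ball x ε, L.weierstrassP z = L.weierstrassP x := by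
    intro z hz
    refine Metric.isOpen_ball.is_const_of_deriv_eq_zero (convex_ball x ε).isPreconnected
      (fun w hw ↦ (hasDerivAt_weierstrassP (hball w hw).1).differentiableAt.differentiableWithinAt)
      (fun w hw ↦ ?_) hz (Metric.mem_ball_self hε)
    rw [L.deriv_weierstrassP]
    exact (hball w hw).2
  obtain ⟨z, hz1, hz2⟩ := ((eventually_weierstrassP_ne hx).and
    (mem_nhdsWithin_of_mem_nhds (Metric.ball_mem_nhds x hε))).exists
  exact hz1 (hconst z hz2)

lemma hasDerivAt_derivWeierstrassP {x : ℂ} (hx : x ∉ τ.periodPair.lattice) :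
    HasDerivAt τ.periodPair.derivWeierstrassP
      (6 * τ.periodPair.weierstrassP x ^ 2 - τ.periodPair.g₂ / 2) x := by
  rw [← deriv_derivWeierstrassP hx]
  exact (τ.periodPair.analyticOnNhd_derivWeierstrassP x hx).differentiableAt.hasDerivAt

/-- The logarithmic derivative of `thetaOneOne_add_mul_sub` in the first variable. -/
lemma thetaLogDeriv_add_add_sub {x y : ℂ} (hx : x ∉ τ.periodPair.lattice)
    (hy : y ∉ τ.periodPair.lattice) (h₁ : x + y ∉ τ.periodPair.lattice)
    (h₂ : x - y ∉ τ.periodPair.lattice) :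
    (τ.thetaLogDeriv (x + y) + τ.thetaLogDeriv (x - y) - 2 * τ.thetaLogDeriv x) *
      (τ.periodPair.weierstrassP x - τ.periodPair.weierstrassP y) =
      τ.periodPair.derivWeierstrassP x := by
  set L := τ.periodPair
  have hθ (z : ℂ) : HasDerivAt (fun z ↦ thetaOneOne z τ)
      (τ.thetaLogDeriv z * thetaOneOne z τ) z ∨ z ∈ L.lattice := by
    by_cases hz : z ∈ L.lattice
    · exact .inr hz
    · left
      rw [thetaLogDeriv, logDeriv_apply, div_mul_cancel₀ _ (τ.thetaOneOne_ne_zero hz)]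
      exact (differentiable_thetaOneOne τ z).hasDerivAt
  have d0 := (hθ x).resolve_right hx
  have d1 := ((hθ (x + y)).resolve_right h₁).comp_add_const x y
  have d2 := ((hθ (x - y)).resolve_right h₂).comp_sub_const x y
  have l := (d1.fun_mul d2).mul_const (τ.thetaReg 0 ^ 2)
  have r := ((d0.fun_pow 2).mul_const (thetaOneOne y τ ^ 2)).fun_mul
    ((hasDerivAt_weierstrassP hx).const_sub (L.weierstrassP y))
  have he : (fun x ↦ thetaOneOne (x + y) τ * thetaOneOne (x - y) τ * τ.thetaReg 0 ^ 2) =ᶠ[𝓝 x]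
      fun x ↦ thetaOneOne x τ ^ 2 * thetaOneOne y τ ^ 2 *
        (L.weierstrassP y - L.weierstrassP x) := by
    filter_upwards [τ.lattice_compl_mem_nhds hx] with w hw using τ.thetaOneOne_add_mul_sub hw hy
  have h := l.unique (r.congr_of_eventuallyEq he)
  have h0 := τ.thetaOneOne_add_mul_sub hx hy
  refine mul_left_cancel₀ (mul_ne_zero (pow_ne_zero 2 (τ.thetaOneOne_ne_zero hx))
    (pow_ne_zero 2 (τ.thetaOneOne_ne_zero hy))) ?_
  push_cast at h
  linear_combination -h + (τ.thetaLogDeriv (x + y) + τ.thetaLogDeriv (x - y)) * h0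

/-- The addition theorem for `θ' / θ`, in a form free of denominators. -/
lemma derivWeierstrassP_sub {x y : ℂ} (hx : x ∉ τ.periodPair.lattice)
    (hy : y ∉ τ.periodPair.lattice) (hxy : x + y ∉ τ.periodPair.lattice) :
    τ.periodPair.derivWeierstrassP x - τ.periodPair.derivWeierstrassP y =
      2 * (τ.periodPair.weierstrassP x - τ.periodPair.weierstrassP y) *
        (τ.thetaLogDeriv (x + y) - τ.thetaLogDeriv x - τ.thetaLogDeriv y) := by
  by_cases h : x - y ∈ τ.periodPair.lattice
  · have h1 := τ.periodPair.weierstrassP_add_coe y ⟨_, h⟩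
    have h2 := τ.periodPair.derivWeierstrassP_add_coe y ⟨_, h⟩
    simp only [add_sub_cancel] at h1 h2
    rw [h1, h2]
    ring
  · have h1 := thetaLogDeriv_add_add_sub hx hy hxy h
    have h2 := thetaLogDeriv_add_add_sub hy hx (by rwa [add_comm])
      (by rwa [← neg_sub, neg_mem_iff])
    rw [← neg_sub x y, thetaLogDeriv_neg, add_comm y x] at h2
    linear_combination -h1 + h2

/-- The derivative of `derivWeierstrassP_sub` in `x`. -/
lemma deriv_derivWeierstrassP_eq {x y : ℂ} (hx : x ∉ τ.periodPair.lattice)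
    (hy : y ∉ τ.periodPair.lattice) (hxy : x + y ∉ τ.periodPair.lattice) :
    6 * τ.periodPair.weierstrassP x ^ 2 - τ.periodPair.g₂ / 2 =
      2 * τ.periodPair.derivWeierstrassP x *
        (τ.thetaLogDeriv (x + y) - τ.thetaLogDeriv x - τ.thetaLogDeriv y) +
      2 * (τ.periodPair.weierstrassP x - τ.periodPair.weierstrassP y) *
        (τ.periodPair.weierstrassP x - τ.periodPair.weierstrassP (x + y)) := by
  have l := (hasDerivAt_derivWeierstrassP hx).sub_const (τ.periodPair.derivWeierstrassP y)
  have r := (((hasDerivAt_weierstrassP hx).sub_const (τ.periodPair.weierstrassP y)).const_mul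
    2).fun_mul ((((τ.hasDerivAt_thetaLogDeriv hxy).comp_add_const x y).fun_sub
      (τ.hasDerivAt_thetaLogDeriv hx)).sub_const (τ.thetaLogDeriv y))
  have hev : ∀ᶠ z in 𝓝 x, z + y ∉ τ.periodPair.lattice :=
    (by fun_prop : Continuous fun z : ℂ ↦ z + y).continuousAt.eventually
      (τ.lattice_compl_mem_nhds hxy)
  have h := l.unique (r.congr_of_eventuallyEq (by
    filter_upwards [hev, τ.lattice_compl_mem_nhds hx] with z h1 h2
      using derivWeierstrassP_sub h2 hy h1))
  linear_combination h

/-- The quadratic relation `(φ(x + y) - φ(x) - φ(y))² = ℘(x) + ℘(y) + ℘(x + y)` for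
`φ = θ' / θ`. -/
lemma thetaLogDeriv_sq {x y : ℂ} (hx : x ∉ τ.periodPair.lattice)
    (hy : y ∉ τ.periodPair.lattice) (hxy : x + y ∉ τ.periodPair.lattice) :
    (τ.thetaLogDeriv (x + y) - τ.thetaLogDeriv x - τ.thetaLogDeriv y) ^ 2 =
      τ.periodPair.weierstrassP x + τ.periodPair.weierstrassP y +
        τ.periodPair.weierstrassP (x + y) := by
  have hne {y : ℂ} (hy : y ∉ τ.periodPair.lattice) (hxy : x + y ∉ τ.periodPair.lattice)
      (h : τ.periodPair.weierstrassP y ≠ τ.periodPair.weierstrassP x) :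
      (τ.thetaLogDeriv (x + y) - τ.thetaLogDeriv x - τ.thetaLogDeriv y) ^ 2 =
      τ.periodPair.weierstrassP x + τ.periodPair.weierstrassP y +
        τ.periodPair.weierstrassP (x + y) := by
    have h1 := deriv_derivWeierstrassP_eq hx hy hxy
    have h2 := deriv_derivWeierstrassP_eq hy hx (by rwa [add_comm])
    rw [add_comm y x] at h2
    have h3 := derivWeierstrassP_sub hx hy hxy
    refine mul_left_cancel₀ (sub_ne_zero.mpr h) ?_
    linear_combination (h1 - h2) / 4 + (τ.thetaLogDeriv (x + y) - τ.thetaLogDeriv x -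
      τ.thetaLogDeriv y) / 2 * h3
  by_cases h : τ.periodPair.weierstrassP y = τ.periodPair.weierstrassP x
  swap
  · exact hne hy hxy h
  -- When `℘(x) = ℘(y)`, the relation follows by continuity in `y`.
  have hadd : ContinuousAt (fun z : ℂ ↦ x + z) y := by fun_prop
  have c1 : ContinuousAt (fun z ↦ τ.thetaLogDeriv (x + z)) y :=
    (τ.analyticAt_thetaLogDeriv hxy).continuousAt.comp (f := fun z ↦ x + z) hadd
  have c2 := (τ.analyticAt_thetaLogDeriv hy).continuousAt
  have c3 : ContinuousAt (fun z ↦ τ.periodPair.weierstrassP (x + z)) y :=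
    (hasDerivAt_weierstrassP hxy).continuousAt.comp (f := fun z ↦ x + z) hadd
  have c4 := (hasDerivAt_weierstrassP hy).continuousAt
  have l : ContinuousAt (fun z ↦ (τ.thetaLogDeriv (x + z) - τ.thetaLogDeriv x -
    τ.thetaLogDeriv z) ^ 2) y := by fun_prop
  have r : ContinuousAt (fun z ↦ τ.periodPair.weierstrassP x + τ.periodPair.weierstrassP z +
    τ.periodPair.weierstrassP (x + z)) y := by fun_prop
  refine tendsto_nhds_unique (l.tendsto.mono_left nhdsWithin_le_nhds)
    ((r.tendsto.mono_left nhdsWithin_le_nhds).congr' (f₁ := fun z ↦ _) ?_ : Tendsto _ (𝓝[≠] y) _)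
  filter_upwards [eventually_weierstrassP_ne hy, τ.eventually_notMem_lattice y,
    mem_nhdsWithin_of_mem_nhds (hadd.preimage_mem_nhds (τ.lattice_compl_mem_nhds hxy))]
    with z h1 h2 h3
  exact (hne h2 h3 (h ▸ h1)).symm

variable (τ)

/-! ### Taylor coefficients of the theta quotient -/

/-- Written with the entire function `θ(z) / z`, the theta quotient needs no exceptional value at
`0`. -/
lemma thetaQuotient_eq (α : ℂ) (hα : α ∉ τ.periodPair.lattice) : thetaQuotient α τ =
    fun z ↦ thetaOneOne (z + α) τ * τ.thetaReg 0 / (τ.thetaReg z * thetaOneOne α τ) := by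
  have hD0 := τ.thetaReg_zero_ne_zero
  have hθα := τ.thetaOneOne_ne_zero hα
  ext z
  rcases eq_or_ne z 0 with rfl | hz
  · simp [thetaQuotient, div_self (mul_ne_zero hD0 hθα), mul_comm (thetaOneOne α τ)]
  · rw [thetaQuotient, Function.update_of_ne hz, ← thetaReg_zero, ← τ.mul_thetaReg z, mul_assoc z,
      mul_assoc z, mul_div_mul_left _ _ hz]

/-- Near `0` the quotient is close to `1`, so the principal branch of the logarithm is
differentiable and its derivative is the logarithmic derivative of the quotient. -/
lemma deriv_log_thetaQuotient {α : ℂ} (hα : α ∉ τ.periodPair.lattice) :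
    deriv (fun z ↦ log (thetaQuotient α τ z)) =ᶠ[𝓝 0]
      fun z ↦ τ.thetaLogDeriv (z + α) - logDeriv τ.thetaReg z := by
  have hD0 := τ.thetaReg_zero_ne_zero
  have hθα := τ.thetaOneOne_ne_zero hα
  have hθ : Differentiable ℂ fun z ↦ thetaOneOne (z + α) τ :=
    (differentiable_thetaOneOne τ).comp (f := fun z ↦ z + α) (by fun_prop)
  have hD := τ.differentiable_thetaReg
  have hcont : ContinuousAt (thetaQuotient α τ) 0 := by
    rw [thetaQuotient_eq τ α hα]
    exact ((hθ.continuous.continuousAt).mul continuousAt_const).div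
      (hD.continuous.continuousAt.mul continuousAt_const) (mul_ne_zero hD0 hθα)
  have h1 : thetaQuotient α τ 0 = 1 := by simp [thetaQuotient]
  have hslit : ∀ᶠ z in 𝓝 0, thetaQuotient α τ z ∈ slitPlane :=
    hcont.eventually_mem (isOpen_slitPlane.mem_nhds (by rw [h1]; exact one_mem_slitPlane))
  filter_upwards [hslit, hD.continuous.continuousAt.eventually_ne hD0,
    hθ.continuous.continuousAt.eventually_ne (by simpa using hθα)] with z hs hz1 hz2
  have hd : DifferentiableAt ℂ (thetaQuotient α τ) z := by
    rw [thetaQuotient_eq τ α hα]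
    exact ((hθ z).mul_const _).div ((hD z).mul_const _) (mul_ne_zero hz1 hθα)
  rw [(hd.hasDerivAt.clog hs).deriv, ← logDeriv_apply, thetaQuotient_eq τ α hα]
  rw [logDeriv_div (f := fun z ↦ thetaOneOne (z + α) τ * τ.thetaReg 0)
    (g := fun z ↦ τ.thetaReg z * thetaOneOne α τ) z (mul_ne_zero hz2 hD0) (mul_ne_zero hz1 hθα)
    ((hθ z).mul_const _) ((hD z).mul_const _), logDeriv_mul_const _ _ hD0,
    logDeriv_mul_const _ _ hθα, thetaLogDeriv, logDeriv_apply,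
    logDeriv_apply (fun z ↦ thetaOneOne z τ),
    deriv_comp_add_const (fun z ↦ thetaOneOne z τ)]

lemma deriv_deriv_log_thetaQuotient {α : ℂ} (hα : α ∉ τ.periodPair.lattice) :
    deriv (deriv fun z ↦ log (thetaQuotient α τ z)) =ᶠ[𝓝 0]
      fun z ↦ -τ.periodPair.weierstrassP (z + α) + τ.periodPair.weierstrassPExcept 0 z := by
  have hev : ∀ᶠ z in 𝓝 (0 : ℂ), z + α ∉ τ.periodPair.lattice :=
    (by fun_prop : Continuous fun z : ℂ ↦ z + α).continuousAt.eventually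
      (p := fun z ↦ z ∉ τ.periodPair.lattice)
      (by simp only [zero_add]; exact τ.lattice_compl_mem_nhds hα)
  filter_upwards [(τ.deriv_log_thetaQuotient hα).eventuallyEq_nhds, hev,
    τ.analyticAt_logDeriv_thetaReg.eventually_analyticAt,
    τ.deriv_logDeriv_thetaReg_eventuallyEq] with z h1 h2 h3 h4
  rw [h1.deriv_eq, (((τ.hasDerivAt_thetaLogDeriv h2).comp_add_const z α).fun_sub
    h3.differentiableAt.hasDerivAt).deriv, h4]
  ring

lemma iteratedDeriv_log_thetaQuotient {α : ℂ} (hα : α ∉ τ.periodPair.lattice) (k : ℕ) :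
    iteratedDeriv (k + 2) (fun z ↦ log (thetaQuotient α τ z)) 0 =
      -iteratedDeriv k τ.periodPair.weierstrassP α +
        iteratedDeriv k (τ.periodPair.weierstrassPExcept 0) 0 := by
  rw [iteratedDeriv_succ', iteratedDeriv_succ',
    (τ.deriv_deriv_log_thetaQuotient hα).iteratedDeriv_eq k]
  have h1 : AnalyticAt ℂ (fun z ↦ τ.periodPair.weierstrassP (z + α)) 0 := by
    have := τ.periodPair.analyticOnNhd_weierstrassP α hα
    rw [← zero_add α] at this
    exact this.fun_comp (f := fun z : ℂ ↦ z + α) (by fun_prop)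
  rw [iteratedDeriv_fun_add h1.fun_neg.contDiffAt
    (τ.periodPair.analyticAt_weierstrassPExcept 0).contDiffAt, iteratedDeriv_fun_neg,
    iteratedDeriv_comp_add_const]
  simp only [zero_add]

/-! ### Recursions for the derivatives of the Weierstrass function -/

lemma iteratedDeriv_weierstrassP {x : ℂ} (hx : x ∉ τ.periodPair.lattice) (n : ℕ) :
    iteratedDeriv (n + 2) τ.periodPair.weierstrassP x =
      6 * ∑ i ∈ Finset.range (n + 1), n.choose i * iteratedDeriv i τ.periodPair.weierstrassP x *
        iteratedDeriv (n - i) τ.periodPair.weierstrassP x -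
      if n = 0 then τ.periodPair.g₂ / 2 else 0 := by
  have hP := τ.periodPair.analyticOnNhd_weierstrassP x hx
  have he : deriv (deriv τ.periodPair.weierstrassP) =ᶠ[𝓝 x] fun z ↦
      6 * (τ.periodPair.weierstrassP z * τ.periodPair.weierstrassP z) - τ.periodPair.g₂ / 2 := by
    filter_upwards [τ.lattice_compl_mem_nhds hx] with z hz
    rw [τ.periodPair.deriv_weierstrassP, deriv_derivWeierstrassP hz, sq]
  rw [iteratedDeriv_succ', iteratedDeriv_succ', he.iteratedDeriv_eq n,
    iteratedDeriv_fun_sub (analyticAt_const.fun_mul (hP.fun_mul hP)).contDiffAt contDiffAt_const,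
    iteratedDeriv_const_mul_field, iteratedDeriv_fun_mul hP.contDiffAt hP.contDiffAt,
    iteratedDeriv_const]

/-- The derivatives at `0` of the regular part `℘(z) - z⁻²` satisfy a recursion which determines
all of them from those of order `2` and `4`. -/
lemma iteratedDeriv_weierstrassPExcept_zero (n : ℕ) :
    ((n + 2) * (n + 1) - 12 : ℂ) *
        iteratedDeriv (n + 2) (τ.periodPair.weierstrassPExcept 0) 0 =
      (n + 2) * (n + 1) * (6 * ∑ i ∈ Finset.range (n + 1), n.choose i *
        iteratedDeriv i (τ.periodPair.weierstrassPExcept 0) 0 *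
        iteratedDeriv (n - i) (τ.periodPair.weierstrassPExcept 0) 0 -
      if n = 0 then τ.periodPair.g₂ / 2 else 0) := by
  set w := τ.periodPair.weierstrassPExcept 0 with hw
  have hwa : AnalyticAt ℂ w 0 := τ.periodPair.analyticAt_weierstrassPExcept 0
  let F : ℂ → ℂ := fun z ↦ deriv (deriv w) z - (6 * (w z * w z) - τ.periodPair.g₂ / 2)
  have hFa : AnalyticAt ℂ F 0 :=
    hwa.deriv.deriv.sub ((analyticAt_const.mul (hwa.mul hwa)).sub analyticAt_const)
  -- Substituting `℘ = w + z⁻²` into `℘'' = 6℘² - g₂ / 2` gives `z² F = 12 w`.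
  have hF : (fun z ↦ z ^ 2 * F z) =ᶠ[𝓝 0] fun z ↦ 12 * w z := by
    have : ∀ᶠ z in 𝓝[≠] (0 : ℂ), z ^ 2 * F z = 12 * w z := by
      filter_upwards [τ.eventually_notMem_lattice 0] with z hz
      have hz0 := τ.ne_zero_of_notMem_lattice hz
      have hL {z : ℂ} (hz : z ∉ τ.periodPair.lattice) :
          HasDerivAt w (τ.periodPair.derivWeierstrassP z + 2 / z ^ 3) z := by
        have h1 : HasDerivAt (fun z : ℂ ↦ 1 / z ^ 2) (-(2 / z ^ 3)) z := by
          have h0 := τ.ne_zero_of_notMem_lattice hz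
          have := (hasDerivAt_pow 2 z).fun_inv (pow_ne_zero 2 h0)
          simp only [one_div]
          convert! this using 1
          field_simp
          norm_num
        have h2 := (hasDerivAt_weierstrassP hz).fun_sub h1
        have h3 : w = fun z ↦ τ.periodPair.weierstrassP z - 1 / z ^ 2 :=
          funext fun z ↦ τ.weierstrassPExcept_zero_eq z
        rw [h3]
        convert! h2 using 1
        ring
      have he : deriv w =ᶠ[𝓝 z] fun z ↦ τ.periodPair.derivWeierstrassP z + 2 / z ^ 3 := by
        filter_upwards [τ.lattice_compl_mem_nhds hz] with y hy using (hL hy).deriv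
      have h4 : HasDerivAt (fun z : ℂ ↦ 2 / z ^ 3) (-(6 / z ^ 4)) z := by
        have := ((hasDerivAt_pow 3 z).fun_inv (pow_ne_zero 3 hz0)).const_mul 2
        simp only [div_eq_mul_inv]
        convert! this using 1
        field_simp
        norm_num
      simp only [F]
      rw [he.deriv_eq, ((hasDerivAt_derivWeierstrassP hz).fun_add h4).deriv, hw,
        weierstrassPExcept_zero_eq]
      field_simp
      ring
    filter_upwards [eventually_nhdsWithin_iff.mp this] with z hz
    rcases eq_or_ne z 0 with rfl | h0
    · simp [hw]
    · exact hz h0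
  have h := hF.iteratedDeriv_eq (n + 2)
  have hsum : iteratedDeriv (n + 2) (fun z ↦ z ^ 2 * F z) 0 =
      (n + 2) * (n + 1) * iteratedDeriv n F 0 := by
    rw [iteratedDeriv_fun_mul (by fun_prop) hFa.contDiffAt,
      Finset.sum_eq_single_of_mem 2 (by simp)]
    · have hc : (((n + 2).choose 2 : ℕ) : ℂ) * 2 = (n + 2) * (n + 1) := by
        rw [Nat.cast_choose_two]
        push_cast
        ring
      rw [iteratedDeriv_fun_pow_zero, Nat.add_sub_cancel, ← hc]
      simp
    · intro b _ hb
      rw [iteratedDeriv_fun_pow_zero, if_neg hb]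
      simp
  have hFn : iteratedDeriv n F 0 = iteratedDeriv (n + 2) w 0 -
      (6 * ∑ i ∈ Finset.range (n + 1), n.choose i * iteratedDeriv i w 0 *
        iteratedDeriv (n - i) w 0 - if n = 0 then τ.periodPair.g₂ / 2 else 0) := by
    rw [iteratedDeriv_fun_sub hwa.deriv.deriv.contDiffAt
      ((analyticAt_const.fun_mul (hwa.fun_mul hwa)).fun_sub analyticAt_const).contDiffAt,
      iteratedDeriv_fun_sub (analyticAt_const.fun_mul (hwa.fun_mul hwa)).contDiffAt
        contDiffAt_const,
      iteratedDeriv_const_mul_field, iteratedDeriv_fun_mul hwa.contDiffAt hwa.contDiffAt,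
      iteratedDeriv_const, iteratedDeriv_succ', iteratedDeriv_succ']
  rw [hsum, hFn, iteratedDeriv_const_mul_field] at h
  linear_combination h

end UpperHalfPlane

section Torsion

open UpperHalfPlane

/-! ### Membership in subalgebras of functions on the upper half plane -/

/-- The function `τ ↦ (θ' / θ)(a / l, τ)`. -/
def torsionLog (l : ℕ) (a : ℤ) (τ : UpperHalfPlane) : ℂ := τ.thetaLogDeriv ((a : ℂ) / l)

/-- The function `τ ↦ ℘⁽ⁿ⁾(a / l)`, for the lattice `ℤ + ℤτ`. -/
def torsionP (l : ℕ) (n : ℕ) (a : ℤ) (τ : UpperHalfPlane) : ℂ :=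
  iteratedDeriv n τ.periodPair.weierstrassP ((a : ℂ) / l)

/-- The function `τ ↦ g₂(ℤ + ℤτ)`. -/
def latticeG₂ (τ : UpperHalfPlane) : ℂ := τ.periodPair.g₂

/-- The `n`-th derivative at `0` of the regular part `℘(z) - z⁻²`, as a function of `τ`. -/
def latticeCoeff (n : ℕ) (τ : UpperHalfPlane) : ℂ :=
  iteratedDeriv n (τ.periodPair.weierstrassPExcept 0) 0

section Formulas

variable {l : ℕ}

lemma div_notMem_lattice (hl : l ≠ 0) {a : ℤ} (ha : ¬(l : ℤ) ∣ a) (τ : UpperHalfPlane) :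
    (a : ℂ) / l ∉ τ.periodPair.lattice :=
  (τ.div_mem_lattice_iff hl a).not.mpr ha

lemma sForm_one (hl : l ≠ 0) {a : ℤ} (ha : ¬(l : ℤ) ∣ a) :
    sForm l a 1 = (2 * Real.pi * Complex.I : ℂ)⁻¹ • torsionLog l a := by
  ext τ
  have h := (τ.deriv_log_thetaQuotient (div_notMem_lattice hl ha τ)).eq_of_nhds
  rw [sForm, iteratedDeriv_one, h, τ.logDeriv_thetaReg_zero]
  simp [torsionLog]

lemma sForm_add_two (hl : l ≠ 0) {a : ℤ} (ha : ¬(l : ℤ) ∣ a) (k : ℕ) :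
    sForm l a (k + 2) =
      ((2 * Real.pi * Complex.I : ℂ) ^ (k + 2))⁻¹ • (-torsionP l k a + latticeCoeff k) := by
  ext τ
  rw [sForm, τ.iteratedDeriv_log_thetaQuotient (div_notMem_lattice hl ha τ)]
  rfl

lemma torsionLog_eq_smul (hl : l ≠ 0) {a : ℤ} (ha : ¬(l : ℤ) ∣ a) :
    torsionLog l a = (2 * Real.pi * Complex.I : ℂ) • sForm l a 1 := by
  rw [sForm_one hl ha, smul_inv_smul₀ Complex.two_pi_I_ne_zero]

lemma torsionP_eq (hl : l ≠ 0) {a : ℤ} (ha : ¬(l : ℤ) ∣ a) (k : ℕ) :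
    torsionP l k a =
      latticeCoeff k - (2 * Real.pi * Complex.I : ℂ) ^ (k + 2) • sForm l a (k + 2) := by
  rw [sForm_add_two hl ha, smul_inv_smul₀ (pow_ne_zero _ Complex.two_pi_I_ne_zero)]
  abel

lemma add_mul_div (hl : l ≠ 0) (a q : ℤ) : ((a + l * q : ℤ) : ℂ) / l = (a : ℂ) / l + q := by
  have : (l : ℂ) ≠ 0 := by exact_mod_cast hl
  push_cast
  field_simp

lemma torsionLog_add_mul (hl : l ≠ 0) (a q : ℤ) : torsionLog l (a + l * q) = torsionLog l a := by
  ext τ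
  rw [torsionLog, add_mul_div hl, τ.thetaLogDeriv_add_intCast, torsionLog]

lemma torsionP_add_mul (hl : l ≠ 0) (n : ℕ) (a q : ℤ) :
    torsionP l n (a + l * q) = torsionP l n a := by
  ext τ
  have h : (fun z ↦ τ.periodPair.weierstrassP (z + (q : ℂ))) = τ.periodPair.weierstrassP :=
    funext fun z ↦ τ.periodPair.weierstrassP_add_coe z ⟨q, τ.intCast_mem_lattice q⟩
  have := congrFun (iteratedDeriv_comp_add_const n τ.periodPair.weierstrassP (q : ℂ)) ((a : ℂ) / l)
  rw [h] at this
  rw [torsionP, add_mul_div hl, torsionP, this]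

lemma torsionLog_neg (a : ℤ) : torsionLog l (-a) = -torsionLog l a := by
  ext τ
  simp [torsionLog, neg_div, thetaLogDeriv_neg]

lemma torsionP_zero_neg (a : ℤ) : torsionP l 0 (-a) = torsionP l 0 a := by
  ext τ
  simp [torsionP, neg_div]

lemma torsionP_one_neg (a : ℤ) : torsionP l 1 (-a) = -torsionP l 1 a := by
  ext τ
  simp [torsionP, neg_div]

lemma add_div_cast (a b : ℤ) : (a : ℂ) / l + (b : ℂ) / l = ((a + b : ℤ) : ℂ) / l := by
  push_cast; ring

lemma torsionP_add_add (hl : l ≠ 0) {a b : ℤ} (ha : ¬(l : ℤ) ∣ a) (hb : ¬(l : ℤ) ∣ b)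
    (hab : ¬(l : ℤ) ∣ a + b) : torsionP l 0 a + torsionP l 0 b + torsionP l 0 (a + b) =
      (torsionLog l (a + b) - torsionLog l a - torsionLog l b) ^ 2 := by
  ext τ
  have h := thetaLogDeriv_sq (div_notMem_lattice hl ha τ) (div_notMem_lattice hl hb τ)
    (by rw [add_div_cast]; exact div_notMem_lattice hl hab τ)
  rw [add_div_cast] at h
  simpa [torsionP, torsionLog] using h.symm

lemma torsionP_one_sub (hl : l ≠ 0) {a b : ℤ} (ha : ¬(l : ℤ) ∣ a) (hb : ¬(l : ℤ) ∣ b)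
    (hab : ¬(l : ℤ) ∣ a + b) : torsionP l 1 a - torsionP l 1 b =
      (2 : ℂ) • ((torsionP l 0 a - torsionP l 0 b) *
        (torsionLog l (a + b) - torsionLog l a - torsionLog l b)) := by
  ext τ
  have h := derivWeierstrassP_sub (div_notMem_lattice hl ha τ) (div_notMem_lattice hl hb τ)
    (by rw [add_div_cast]; exact div_notMem_lattice hl hab τ)
  rw [add_div_cast] at h
  simpa [torsionP, torsionLog, mul_assoc] using h

lemma latticeG₂_eq (hl : l ≠ 0) {a : ℤ} (ha : ¬(l : ℤ) ∣ a) (ha2 : ¬(l : ℤ) ∣ a + a) :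
    latticeG₂ = (12 : ℂ) • torsionP l 0 a ^ 2 -
      (4 : ℂ) • (torsionP l 1 a * (torsionLog l (a + a) - torsionLog l a - torsionLog l a)) := by
  ext τ
  have h := deriv_derivWeierstrassP_eq (div_notMem_lattice hl ha τ) (div_notMem_lattice hl ha τ)
    (by rw [add_div_cast]; exact div_notMem_lattice hl ha2 τ)
  rw [add_div_cast] at h
  simp only [torsionP, torsionLog, latticeG₂, iteratedDeriv_zero, iteratedDeriv_one,
    PeriodPair.deriv_weierstrassP, Pi.sub_apply, Pi.smul_apply, Pi.mul_apply, Pi.pow_apply,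
    smul_eq_mul]
  linear_combination -2 * h

lemma torsionP_recursion (hl : l ≠ 0) {a : ℤ} (ha : ¬(l : ℤ) ∣ a) (n : ℕ) :
    torsionP l (n + 2) a = (6 : ℂ) • ∑ i ∈ Finset.range (n + 1),
      (n.choose i : ℂ) • (torsionP l i a * torsionP l (n - i) a) -
      if n = 0 then (2⁻¹ : ℂ) • latticeG₂ else 0 := by
  ext τ
  rw [torsionP, iteratedDeriv_weierstrassP τ (div_notMem_lattice hl ha τ)]
  simp only [Pi.sub_apply, Pi.smul_apply, Finset.sum_apply, Pi.mul_apply, smul_eq_mul, torsionP,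
    mul_assoc]
  split_ifs <;> simp [latticeG₂, div_eq_inv_mul]

lemma latticeCoeff_eq_smul (n : ℕ) (hn : ((n + 2) * (n + 1) - 12 : ℂ) ≠ 0) :
    latticeCoeff (n + 2) = (((n + 2) * (n + 1) - 12 : ℂ)⁻¹ * ((n + 2) * (n + 1))) •
      ((6 : ℂ) • ∑ i ∈ Finset.range (n + 1),
        (n.choose i : ℂ) • (latticeCoeff i * latticeCoeff (n - i)) -
        if n = 0 then (2⁻¹ : ℂ) • latticeG₂ else 0) := by
  ext τ
  have h := iteratedDeriv_weierstrassPExcept_zero τ n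
  rw [Pi.smul_apply, smul_eq_mul, mul_assoc, eq_inv_mul_iff_mul_eq₀ hn, latticeCoeff, h]
  simp only [Pi.sub_apply, Pi.smul_apply, Finset.sum_apply, Pi.mul_apply, smul_eq_mul,
    latticeCoeff, mul_assoc]
  split_ifs <;> simp [latticeG₂, div_eq_inv_mul]

lemma latticeCoeff_zero : latticeCoeff 0 = 0 := by
  ext τ
  simp [latticeCoeff]

lemma latticeCoeff_one : latticeCoeff 1 = 0 := by
  ext τ
  simp [latticeCoeff]

lemma latticeCoeff_two : latticeCoeff 2 = (10⁻¹ : ℂ) • latticeG₂ := by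
  ext τ
  rw [latticeCoeff, PeriodPair.iteratedDeriv_weierstrassPExcept_self]
  simp [latticeG₂, PeriodPair.g₂, Nat.factorial]
  ring

lemma latticeCoeff_three : latticeCoeff 3 = 0 := by
  ext τ
  rw [latticeCoeff, PeriodPair.iteratedDeriv_weierstrassPExcept_self]
  simp [PeriodPair.G_eq_zero_of_odd _ 5 (by decide)]

/-- The coefficient of order `4` is proportional to `g₃`, which the equation of the curve expresses
through `g₂` and the coordinates of any point. -/
lemma latticeCoeff_four (hl : l ≠ 0) {a : ℤ} (ha : ¬(l : ℤ) ∣ a) :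
    latticeCoeff 4 = (6 / 7 : ℂ) • ((4 : ℂ) • torsionP l 0 a ^ 3 - latticeG₂ * torsionP l 0 a -
      torsionP l 1 a ^ 2) := by
  ext τ
  have h := τ.periodPair.derivWeierstrassP_sq _ (div_notMem_lattice hl ha τ)
  rw [latticeCoeff, PeriodPair.iteratedDeriv_weierstrassPExcept_self]
  simp only [torsionP, latticeG₂, iteratedDeriv_zero, iteratedDeriv_one,
    PeriodPair.deriv_weierstrassP, Pi.sub_apply, Pi.smul_apply, Pi.mul_apply, Pi.pow_apply,
    smul_eq_mul, h, PeriodPair.g₃, PeriodPair.sumInvPow_zero, Nat.factorial]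
  norm_num
  ring

end Formulas

section Membership

variable {A : Subalgebra ℂ (UpperHalfPlane → ℂ)} {l : ℕ}

lemma torsionP_mem (hl : l ≠ 0) {a : ℤ} (ha : ¬(l : ℤ) ∣ a) (h0 : torsionP l 0 a ∈ A)
    (h1 : torsionP l 1 a ∈ A) (hg : latticeG₂ ∈ A) (n : ℕ) : torsionP l n a ∈ A := by
  induction n using Nat.strong_induction_on with
  | _ n ih =>
    match n with
    | 0 => exact h0
    | 1 => exact h1
    | n + 2 =>
      rw [torsionP_recursion hl ha]
      refine sub_mem (A.smul_mem (sum_mem fun i hi ↦ A.smul_mem (mul_mem ?_ ?_) _) _) ?_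
      · exact ih i (by have := Finset.mem_range.mp hi; omega)
      · exact ih (n - i) (by omega)
      · split_ifs
        · exact A.smul_mem hg _
        · exact zero_mem A

lemma latticeCoeff_mem (hg : latticeG₂ ∈ A) (h4 : latticeCoeff 4 ∈ A) (n : ℕ) :
    latticeCoeff n ∈ A := by
  induction n using Nat.strong_induction_on with
  | _ n ih =>
    match n with
    | 0 => rw [latticeCoeff_zero]; exact zero_mem A
    | 1 => rw [latticeCoeff_one]; exact zero_mem A
    | 2 => rw [latticeCoeff_two]; exact A.smul_mem hg _
    | 3 => rw [latticeCoeff_three]; exact zero_mem A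
    | 4 => exact h4
    | n + 5 =>
      have hn : (((n + 3 : ℕ) + 2) * ((n + 3 : ℕ) + 1) - 12 : ℂ) ≠ 0 := by
        have : (((n + 3 : ℕ) + 2) * ((n + 3 : ℕ) + 1) - 12 : ℂ) =
            ((n ^ 2 + 9 * n + 8 : ℕ) : ℂ) := by
          push_cast; ring
        rw [this]
        exact_mod_cast (by positivity : n ^ 2 + 9 * n + 8 ≠ 0)
      rw [latticeCoeff_eq_smul (n + 3) hn]
      refine A.smul_mem (sub_mem (A.smul_mem (sum_mem fun i hi ↦
        A.smul_mem (mul_mem ?_ ?_) _) _) ?_) _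
      · exact ih i (by have := Finset.mem_range.mp hi; omega)
      · exact ih (n + 3 - i) (by omega)
      · rw [if_neg (by omega)]
        exact zero_mem A

/-- A subalgebra contains every `s⁽ᵏ⁾` at a torsion point as soon as it contains `θ' / θ`, `℘` and
`℘'` there, together with `g₂`. -/
lemma sForm_mem (hl : l ≠ 0) {a : ℤ} (ha : ¬(l : ℤ) ∣ a) (hφ : torsionLog l a ∈ A)
    (h0 : torsionP l 0 a ∈ A) (h1 : torsionP l 1 a ∈ A) (hg : latticeG₂ ∈ A) {k : ℕ}
    (hk : 1 ≤ k) : sForm l a k ∈ A := by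
  have h4 : latticeCoeff 4 ∈ A := by
    rw [latticeCoeff_four hl ha]
    exact A.smul_mem (sub_mem (sub_mem (A.smul_mem (pow_mem h0 3) _) (mul_mem hg h0))
      (pow_mem h1 2)) _
  obtain ⟨k, rfl⟩ := Nat.exists_eq_add_of_le' hk
  rcases k with - | k
  · rw [zero_add, sForm_one hl ha]
    exact A.smul_mem hφ _
  · rw [sForm_add_two hl ha]
    exact A.smul_mem (add_mem (neg_mem (torsionP_mem hl ha h0 h1 hg k))
      (latticeCoeff_mem hg h4 k)) _

/-- Everything at level `l ≥ 3` is generated by the values of `θ' / θ` at the `l`-torsion points,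
together with `℘(1 / l)` and `℘'(1 / l)`. -/
lemma sForm_mem_of_one (hl : 3 ≤ l) (hφ : ∀ n : ℕ, 1 ≤ n → n < l → torsionLog l n ∈ A)
    (h0 : torsionP l 0 1 ∈ A) (h1 : torsionP l 1 1 ∈ A) {a : ℤ} (ha : ¬(l : ℤ) ∣ a) {k : ℕ}
    (hk : 1 ≤ k) : sForm l a k ∈ A := by
  have hl0 : l ≠ 0 := by omega
  have hdvd (n : ℕ) (h : 1 ≤ n) (h' : n < l) : ¬(l : ℤ) ∣ n := by
    rw [Int.natCast_dvd_natCast]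
    exact Nat.not_dvd_of_pos_of_lt h h'
  have hdvd1 := hdvd 1 le_rfl (by omega)
  have hP (n : ℕ) (hn : 1 ≤ n) : n < l → torsionP l 0 n ∈ A := by
    induction n, hn using Nat.le_induction with
    | base => intro _; simpa using h0
    | succ n hn ih =>
      intro h
      have hd := hdvd (n + 1) (by omega) h
      have hrel := torsionP_add_add hl0 (hdvd n hn (by omega)) hdvd1 (by exact_mod_cast hd)
      have : torsionP l 0 ((n + 1 : ℕ) : ℤ) = (torsionLog l ((n + 1 : ℕ) : ℤ) - torsionLog l n -
          torsionLog l (1 : ℕ)) ^ 2 - torsionP l 0 n - torsionP l 0 (1 : ℕ) := by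
        push_cast at hrel ⊢
        rw [← hrel]
        ring
      rw [this]
      exact sub_mem (sub_mem (pow_mem (sub_mem (sub_mem (hφ _ (by omega) h)
        (hφ n hn (by omega))) (hφ 1 le_rfl (by omega))) 2) (ih (by omega))) (by simpa using h0)
  have hP' (n : ℕ) (hn : 1 ≤ n) (h : n < l) : torsionP l 1 n ∈ A := by
    rcases Nat.lt_or_ge (n + 1) l with h' | h'
    · have hd := hdvd (n + 1) (by omega) h'
      have hrel := torsionP_one_sub hl0 (hdvd n hn h) hdvd1 (by exact_mod_cast hd)
      rw [← Nat.cast_add] at hrel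
      rw [sub_eq_iff_eq_add.mp hrel]
      exact add_mem (A.smul_mem (mul_mem (sub_mem (hP n hn h) (by simpa using h0))
        (sub_mem (sub_mem (hφ _ (by omega) h') (hφ n hn h)) (hφ 1 le_rfl (by omega)))) _)
        (by simpa using h1)
    · have : (n : ℤ) = -1 + l * 1 := by omega
      rw [this, torsionP_add_mul hl0, torsionP_one_neg]
      exact neg_mem h1
  have hg : latticeG₂ ∈ A := by
    have hd := hdvd 2 (by omega) (by omega)
    rw [latticeG₂_eq (a := 1) hl0 (by exact_mod_cast hdvd1) (by exact_mod_cast hd)]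
    have hφ1 : torsionLog l 1 ∈ A := by simpa using hφ 1 le_rfl (by omega)
    have hφ2 : torsionLog l (1 + 1) ∈ A := by simpa using hφ 2 (by omega) (by omega)
    exact sub_mem (A.smul_mem (pow_mem h0 2) _)
      (A.smul_mem (mul_mem h1 (sub_mem (sub_mem hφ2 hφ1) hφ1)) _)
  obtain ⟨n, hn⟩ := Int.eq_ofNat_of_zero_le (Int.emod_nonneg a (by omega : (l : ℤ) ≠ 0))
  have hn1 : 1 ≤ n := by
    have := mt Int.dvd_of_emod_eq_zero ha
    omega
  have hnl : n < l := by
    have := Int.emod_lt_of_pos a (by omega : (0 : ℤ) < l)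
    omega
  have hr : a = n + l * (a / l) := by
    rw [← hn]
    exact (Int.emod_add_mul_ediv a l).symm
  refine sForm_mem hl0 ha ?_ ?_ ?_ hg hk <;> rw [hr]
  · rw [torsionLog_add_mul hl0]; exact hφ n hn1 hnl
  · rw [torsionP_add_mul hl0]; exact hP n hn1 hnl
  · rw [torsionP_add_mul hl0]; exact hP' n hn1 hnl

end Membership

/-! ### Generators at each level -/

lemma sForm_mem_of_five_le {l : ℕ} (hl : 5 ≤ l) {a : ℤ} (ha : ¬(l : ℤ) ∣ a) {k : ℕ} (hk : 1 ≤ k) :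
    sForm l a k ∈ Algebra.adjoin ℂ
      {f : UpperHalfPlane → ℂ | ∃ b : ℤ, 1 ≤ b ∧ b ≤ (l : ℤ) - 1 ∧ f = sForm l b 1} := by
  set A := Algebra.adjoin ℂ
    {f : UpperHalfPlane → ℂ | ∃ b : ℤ, 1 ≤ b ∧ b ≤ (l : ℤ) - 1 ∧ f = sForm l b 1}
  have hl0 : l ≠ 0 := by omega
  have hdvd (n : ℕ) (h : 1 ≤ n) (h' : n < l) : ¬(l : ℤ) ∣ n := by
    rw [Int.natCast_dvd_natCast]
    exact Nat.not_dvd_of_pos_of_lt h h'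
  have hφ (n : ℕ) (h : 1 ≤ n) (h' : n < l) : torsionLog l n ∈ A := by
    rw [torsionLog_eq_smul hl0 (hdvd n h h')]
    exact A.smul_mem (Algebra.subset_adjoin ⟨n, by omega, by omega, rfl⟩) _
  have hrel (m n : ℕ) (hm : 1 ≤ m) (hn : 1 ≤ n) (h : m + n < l) :
      torsionP l 0 m + torsionP l 0 n + torsionP l 0 ((m + n : ℕ) : ℤ) ∈ A := by
    have hd := hdvd (m + n) (by omega) h
    rw [Nat.cast_add, torsionP_add_add hl0 (hdvd m hm (by omega)) (hdvd n hn (by omega))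
      (by exact_mod_cast hd), ← Nat.cast_add]
    exact pow_mem (sub_mem (sub_mem (hφ _ (by omega) h) (hφ m hm (by omega)))
      (hφ n hn (by omega))) 2
  have r11 := hrel 1 1 le_rfl le_rfl (by omega)
  have r12 := hrel 1 2 le_rfl (by omega) (by omega)
  have r13 := hrel 1 3 le_rfl (by omega) (by omega)
  have r22 := hrel 2 2 (by omega) (by omega) (by omega)
  push_cast at r11 r12 r13 r22
  have h0 : torsionP l 0 1 ∈ A := by
    -- The four relations determine `℘(1 / l)`, which is where `l ≥ 5` enters.
    have h6 := sub_mem (add_mem (sub_mem (A.smul_mem r11 (3 : ℂ)) r22) r13) r12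
    have h : torsionP l 0 1 = (6⁻¹ : ℂ) • ((3 : ℂ) • (torsionP l 0 1 + torsionP l 0 1 +
        torsionP l 0 2) - (torsionP l 0 2 + torsionP l 0 2 + torsionP l 0 4) +
        (torsionP l 0 1 + torsionP l 0 3 + torsionP l 0 4) -
        (torsionP l 0 1 + torsionP l 0 2 + torsionP l 0 3)) := by
      module
    rw [h]
    exact A.smul_mem h6 _
  have h02 : torsionP l 0 2 ∈ A := by
    have := sub_mem (sub_mem r11 h0) h0
    simpa [add_sub_cancel_left, add_assoc] using this
  have hφ1 : torsionLog l 1 ∈ A := by simpa using hφ 1 le_rfl (by omega)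
  have hφ2 : torsionLog l 2 ∈ A := by simpa using hφ 2 (by omega) (by omega)
  have hφ3 : torsionLog l 3 ∈ A := by simpa using hφ 3 (by omega) (by omega)
  have d1 : ¬(l : ℤ) ∣ 1 := by exact_mod_cast hdvd 1 le_rfl (by omega)
  have d2 : ¬(l : ℤ) ∣ 2 := by exact_mod_cast hdvd 2 (by omega) (by omega)
  have d3 : ¬(l : ℤ) ∣ 3 := by exact_mod_cast hdvd 3 (by omega) (by omega)
  have h1 : torsionP l 1 1 ∈ A := by
    -- `℘'(1/l) - ℘'(2/l)` and `℘'(1/l) - ℘'(-2/l) = ℘'(1/l) + ℘'(2/l)` both lie in `A`.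
    have e1 := torsionP_one_sub (a := 1) (b := 2) hl0 d1 d2 (by norm_num; exact d3)
    have e2 := torsionP_one_sub (a := 1) (b := -2) hl0 d1 (by rwa [dvd_neg])
      (by norm_num; simpa using d1)
    norm_num at e1 e2
    rw [torsionP_zero_neg, torsionP_one_neg, torsionLog_neg, torsionLog_neg] at e2
    have m1 : torsionP l 1 1 - torsionP l 1 2 ∈ A := by
      rw [e1]
      exact A.smul_mem (mul_mem (sub_mem h0 h02) (sub_mem (sub_mem hφ3 hφ1) hφ2)) _
    have m2 : torsionP l 1 1 - -torsionP l 1 2 ∈ A := by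
      rw [e2]
      exact A.smul_mem (mul_mem (sub_mem h0 h02)
        (sub_mem (sub_mem (neg_mem hφ1) hφ1) (neg_mem hφ2))) _
    have : torsionP l 1 1 = (2⁻¹ : ℂ) • ((torsionP l 1 1 - torsionP l 1 2) +
        (torsionP l 1 1 - -torsionP l 1 2)) := by
      module
    rw [this]
    exact A.smul_mem (add_mem m1 m2) _
  exact sForm_mem_of_one (by omega) hφ h0 h1 ha hk

/-- At a point of order two, `θ' / θ` vanishes. -/
lemma torsionLog_eq_zero {l : ℕ} (hl : l ≠ 0) {a : ℤ} (ha : a + a = l) : torsionLog l a = 0 := by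
  have h := torsionLog_add_mul hl (-a) 1
  rw [mul_one, ← ha, neg_add_cancel_left, torsionLog_neg] at h
  exact funext fun τ ↦ CharZero.eq_neg_self_iff.mp (congrFun h τ)

/-- At a point of order two, `℘'` vanishes. -/
lemma torsionP_one_eq_zero {l : ℕ} (hl : l ≠ 0) {a : ℤ} (ha : a + a = l) : torsionP l 1 a = 0 := by
  have h := torsionP_add_mul hl 1 (-a) 1
  rw [mul_one, ← ha, neg_add_cancel_left, torsionP_one_neg] at h
  exact funext fun τ ↦ CharZero.eq_neg_self_iff.mp (congrFun h τ)

lemma sForm_four_mem {a : ℤ} (ha : ¬(4 : ℤ) ∣ a) {k : ℕ} (hk : 1 ≤ k) :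
    sForm 4 a k ∈ Algebra.adjoin ℂ
      ({sForm 4 1 1, sForm 4 1 2} : Set (UpperHalfPlane → ℂ)) := by
  set A := Algebra.adjoin ℂ ({sForm 4 1 1, sForm 4 1 2} : Set (UpperHalfPlane → ℂ))
  have d1 : ¬((4 : ℕ) : ℤ) ∣ 1 := by decide
  have d2 : ¬((4 : ℕ) : ℤ) ∣ 2 := by decide
  have d3 : ¬((4 : ℕ) : ℤ) ∣ 3 := by decide
  have hφ1 : torsionLog 4 1 ∈ A := by
    rw [torsionLog_eq_smul (by norm_num) d1]
    exact A.smul_mem (Algebra.subset_adjoin (by simp)) _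
  have hφ2 : torsionLog 4 2 = 0 := torsionLog_eq_zero (by norm_num) (by norm_num)
  have hφ3 : torsionLog 4 3 = -torsionLog 4 1 := by
    have := torsionLog_add_mul (l := 4) (by norm_num) (-1) 1
    rw [torsionLog_neg] at this
    exact_mod_cast this
  have h0 : torsionP 4 0 1 ∈ A := by
    rw [torsionP_eq (by norm_num) d1, latticeCoeff_zero]
    exact sub_mem (zero_mem A) (A.smul_mem (Algebra.subset_adjoin (by simp)) _)
  have h02 : torsionP 4 0 2 ∈ A := by
    have h := torsionP_add_add (l := 4) (a := 1) (b := 1) (by norm_num) d1 d1 d2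
    norm_num [hφ2] at h
    rw [← eq_sub_iff_add_eq'] at h
    rw [h]
    exact sub_mem (pow_mem (sub_mem (neg_mem hφ1) hφ1) 2) (add_mem h0 h0)
  have h1 : torsionP 4 1 1 ∈ A := by
    have h := torsionP_one_sub (l := 4) (a := 1) (b := 2) (by norm_num) d1 d2 d3
    rw [torsionP_one_eq_zero (by norm_num) (by norm_num : (2 : ℤ) + 2 = (4 : ℕ)), sub_zero] at h
    norm_num [hφ2, hφ3] at h
    rw [h]
    exact A.smul_mem (mul_mem (sub_mem h0 h02) (sub_mem (neg_mem hφ1) hφ1)) _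
  refine sForm_mem_of_one (by norm_num) (fun n hn hn4 ↦ ?_) h0 h1 ha hk
  interval_cases n
  · exact_mod_cast hφ1
  · exact_mod_cast hφ2 ▸ zero_mem A
  · exact_mod_cast hφ3 ▸ neg_mem hφ1

lemma sForm_three_mem {a : ℤ} (ha : ¬(3 : ℤ) ∣ a) {k : ℕ} (hk : 1 ≤ k) :
    sForm 3 a k ∈ Algebra.adjoin ℂ
      ({sForm 3 1 1, sForm 3 1 3} : Set (UpperHalfPlane → ℂ)) := by
  set A := Algebra.adjoin ℂ ({sForm 3 1 1, sForm 3 1 3} : Set (UpperHalfPlane → ℂ))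
  have d1 : ¬((3 : ℕ) : ℤ) ∣ 1 := by decide
  have d2 : ¬((3 : ℕ) : ℤ) ∣ 2 := by decide
  have hφ1 : torsionLog 3 1 ∈ A := by
    rw [torsionLog_eq_smul (by norm_num) d1]
    exact A.smul_mem (Algebra.subset_adjoin (by simp)) _
  have hφ2 : torsionLog 3 2 = -torsionLog 3 1 := by
    have := torsionLog_add_mul (l := 3) (by norm_num) (-1) 1
    rw [torsionLog_neg] at this
    exact_mod_cast this
  have h02 : torsionP 3 0 2 = torsionP 3 0 1 := by
    have := torsionP_add_mul (l := 3) (by norm_num) 0 (-1) 1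
    rw [torsionP_zero_neg] at this
    exact_mod_cast this
  have h0 : torsionP 3 0 1 ∈ A := by
    have h := torsionP_add_add (l := 3) (a := 1) (b := 1) (by norm_num) d1 d1 d2
    norm_num [hφ2, h02] at h
    have h' : torsionP 3 0 1 =
        (3⁻¹ : ℂ) • (torsionP 3 0 1 + torsionP 3 0 1 + torsionP 3 0 1) := by
      module
    rw [h', h]
    exact A.smul_mem (pow_mem (sub_mem (sub_mem (neg_mem hφ1) hφ1) hφ1) 2) _
  have h1 : torsionP 3 1 1 ∈ A := by
    rw [torsionP_eq (by norm_num) d1, latticeCoeff_one]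
    exact sub_mem (zero_mem A) (A.smul_mem (Algebra.subset_adjoin (by simp)) _)
  refine sForm_mem_of_one (by norm_num) (fun n hn hn3 ↦ ?_) h0 h1 ha hk
  interval_cases n
  · exact_mod_cast hφ1
  · exact_mod_cast hφ2 ▸ neg_mem hφ1

lemma sForm_two_mem {a : ℤ} (ha : ¬(2 : ℤ) ∣ a) {k : ℕ} (hk : 1 ≤ k) :
    sForm 2 a k ∈ Algebra.adjoin ℂ
      ({sForm 2 1 2, sForm 2 1 4} : Set (UpperHalfPlane → ℂ)) := by
  set A := Algebra.adjoin ℂ ({sForm 2 1 2, sForm 2 1 4} : Set (UpperHalfPlane → ℂ))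
  have d1 : ¬((2 : ℕ) : ℤ) ∣ 1 := by decide
  have h0 : torsionP 2 0 1 ∈ A := by
    rw [torsionP_eq (by norm_num) d1, latticeCoeff_zero]
    exact sub_mem (zero_mem A) (A.smul_mem (Algebra.subset_adjoin (by simp)) _)
  have hg : latticeG₂ ∈ A := by
    -- `℘'' = 6℘² - g₂ / 2`, while the Taylor coefficient of order two is `g₂ / 10`.
    have h := torsionP_recursion (l := 2) (by norm_num) d1 0
    have h' := torsionP_eq (l := 2) (by norm_num) d1 2
    rw [latticeCoeff_two] at h'
    simp only [zero_add, Finset.range_one, Finset.sum_singleton, Nat.choose_self, Nat.cast_one,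
      one_smul, Nat.sub_self, if_true] at h
    rw [h] at h'
    have e : latticeG₂ = (5 / 3 : ℂ) • ((6 : ℂ) • (torsionP 2 0 1 * torsionP 2 0 1) +
        (2 * Real.pi * Complex.I : ℂ) ^ (2 + 2) • sForm 2 1 (2 + 2)) := by
      ext τ
      have := congrFun h' τ
      simp only [Pi.sub_apply, Pi.add_apply, Pi.smul_apply, Pi.mul_apply, smul_eq_mul] at this ⊢
      linear_combination (-5 / 3 : ℂ) * this
    rw [e]
    exact A.smul_mem (add_mem (A.smul_mem (mul_mem h0 h0) _)
      (A.smul_mem (Algebra.subset_adjoin (by simp)) _)) _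
  obtain ⟨q, rfl⟩ : ∃ q : ℤ, a = 1 + (2 : ℕ) * q := ⟨a / 2, by omega⟩
  refine sForm_mem (by norm_num) (by exact_mod_cast ha) ?_ ?_ ?_ hg hk
  · rw [torsionLog_add_mul (by norm_num), torsionLog_eq_zero (by norm_num) (by norm_num)]
    exact zero_mem A
  · rwa [torsionP_add_mul (by norm_num)]
  · rw [torsionP_add_mul (by norm_num), torsionP_one_eq_zero (by norm_num) (by norm_num)]
    exact zero_mem A

end Torsion

end

theorem mainTheorem9 :
    (∀ l : ℕ, 5 ≤ l → ∀ a : ℤ, ¬ (l : ℤ) ∣ a → ∀ k : ℕ, 1 ≤ k →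
      sForm l a k ∈ Algebra.adjoin ℂ
        {f : UpperHalfPlane → ℂ | ∃ b : ℤ, 1 ≤ b ∧ b ≤ (l : ℤ) - 1 ∧ f = sForm l b 1}) ∧
    (∀ a : ℤ, ¬ (4 : ℤ) ∣ a → ∀ k : ℕ, 1 ≤ k →
      sForm 4 a k ∈ Algebra.adjoin ℂ
        ({sForm 4 1 1, sForm 4 1 2} : Set (UpperHalfPlane → ℂ))) ∧
    (∀ a : ℤ, ¬ (3 : ℤ) ∣ a → ∀ k : ℕ, 1 ≤ k →
      sForm 3 a k ∈ Algebra.adjoin ℂ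
        ({sForm 3 1 1, sForm 3 1 3} : Set (UpperHalfPlane → ℂ))) ∧
    (∀ a : ℤ, ¬ (2 : ℤ) ∣ a → ∀ k : ℕ, 1 ≤ k →
      sForm 2 a k ∈ Algebra.adjoin ℂ
        ({sForm 2 1 2, sForm 2 1 4} : Set (UpperHalfPlane → ℂ))) :=
  ⟨fun _ hl _ ha _ hk ↦ sForm_mem_of_five_le hl ha hk, fun _ ha _ hk ↦ sForm_four_mem ha hk,
    fun _ ha _ hk ↦ sForm_three_mem ha hk, fun _ ha _ hk ↦ sForm_two_mem ha hk⟩
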